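/- Let $\epsilon\in\{-1,0,1\}$ and let $\mathbb{Q}_\epsilon^n$ be $\mathbb{H}^n$, $\mathbb{R}^n$ or $\mathbb{S}^n$ according as $\epsilon=-1,0,1$. Let $\mathbb{E}^{n+1}$ be Lorentzian space $\mathbb{L}^{n+1}$ (with metric $-dx_0^2+dx_1^2+\dots+dx_n^2$) if $\epsilon=-1$ and Euclidean space $\mathbb{R}^{n+1}$ otherwise, and regard $\mathbb{Q}_\epsilon^n\subset\mathbb{E}^{n+1}$ as $\{\langle x,x\rangle=-1,\ x_0>0\}$ if $\epsilon=-1$, as the affine hyperplane $\{x_0=1\}$ if $\epsilon=0$, and as the unit sphere if $\epsilon=1$; thus $\mathbb{Q}_\epsilon^n\times\mathbb{R}\subset\mathbb{E}^{n+2}=\mathbb{E}^{n+1}\times\mathbb{R}$. Let $\partial/\partial t$ be the unit vector field tangent to the factor $\mathbb{R}$. All manifolds and maps are smooth ($C^\infty$), manifolds have no boundary, and immersed manifolds carry the induced metric. For an immersion $f\colon M^m\to\mathbb{Q}_\epsilon^n\times\mathbb{R}$ write $\partial/\partial t=f_*T+\eta$ with $T$ tangent to $M$ and $\eta$ normal to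 $f$. The immersion $f$ is in class $\mathcal{A}$ if at every point $T$ is an eigenvector (in particular $T\ne0$) of the shape operators $A^f_\zeta$ of $f$ in $\mathbb{Q}_\epsilon^n\times\mathbb{R}$ for all normal vectors $\zeta$, where $\langle A^f_\zeta X,Y\rangle=\langle\alpha_f(X,Y),\zeta\rangle$ and $\alpha_f$ is the second fundamental form. Construction. Let $m\ge1$, $k\ge 0$, let $g\colon N^{m-1}\to\mathbb{Q}_\epsilon^n$ be an immersion with an orthonormal set $\xi_1,\dots,\xi_k$ of normal vector fields along $g$ that are parallel in the normal connection, and let $\alpha=(\alpha_0,\dots,\alpha_k,\alpha_{k+1})\colon I\to\mathbb{Q}_\epsilon^k\times\mathbb{R}\subset\mathbb{E}^{k+2}$ be a regular curve on an open interval $I$ such that $\alpha_{k+1}'$ vanishes nowhere. Regard $g,\xi_1,\dots,\xi_k$ as maps into $\mathbb{E}^{n+1}\times\{0\}\subset\mathbb{E}^{n+2}$ and define $$f\colon N^{m-1}\times I\to\mathbb{E}^{n+2},\qquad f(x,s)=\alpha_0(s)\,g(x)+\sum_{i=1}^k\alpha_i(s)\,\xi_i(x)+\alpha_{k+1}(s)\,\frac{\partial}{\partial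 t}.\qquad(1)$$ Theorem. (a) The map $f$ in (1) takes values in $\mathbb{Q}_\epsilon^n\times\mathbb{R}$ and defines, at its regular points (the points where its differential is injective), an immersion in class $\mathcal{A}$. (b) Conversely, every immersion $f\colon M^m\to\mathbb{Q}_\epsilon^n\times\mathbb{R}$, $m\ge2$, in class $\mathcal{A}$ is locally given in this way: for every $x_0\in M$ there are an integer $k\ge0$, data $N^{m-1}$, $g$, $\xi_1,\dots,\xi_k$, $I$, $\alpha$ as in the construction, and a diffeomorphism $\psi$ from $N^{m-1}\times I$ onto an open neighbourhood of $x_0$ in $M$ such that $f\circ\psi$ is the map (1). -/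

import Mathlib

open scoped Manifold ContDiff Topology

namespace ClassA

/-- The vector space underlying the flat space `𝔼^{n+1}`, with coordinates `x_0, …, x_n`. -/
abbrev Flat (n : ℕ) : Type := Fin (n + 1) → ℝ

/-- The sign of `dx_0²` in the flat metric of `𝔼^{n+1}`: it is `-1` in the Lorentzian case
`ε = -1`, and `1` in the Euclidean cases `ε = 0, 1`. -/
def metricSign (ε : SignType) : ℝ := if ε = -1 then -1 else 1

/-- The flat metric of `𝔼^{n+1}`. -/
def flatInner (ε : SignType) {n : ℕ} (v w : Flat n) : ℝ :=
  metricSign ε * (v 0 * w 0) + ∑ i : Fin n, v i.succ * w i.succ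

/-- The flat metric of `𝔼^{n+2} = 𝔼^{n+1} × ℝ`. -/
def flatInnerProd (ε : SignType) {n : ℕ} (v w : Flat n × ℝ) : ℝ :=
  flatInner ε v.1 w.1 + v.2 * w.2

/-- The space form `ℚ_ε^n ⊆ 𝔼^{n+1}`: the unit sphere if `ε = 1`, the upper sheet of the
hyperboloid if `ε = -1`, and Euclidean space `ℝ^n`, realized as the affine hyperplane `x_0 = 1`
of the Euclidean space `ℝ^{n+1}`, if `ε = 0`. -/
def spaceForm (ε : SignType) (n : ℕ) : Set (Flat n) :=
  match ε with
  | .pos => {x | flatInner 1 x x = 1}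
  | .neg => {x | flatInner (-1) x x = -1 ∧ 0 < x 0}
  | .zero => {x | x 0 = 1}

/-- The tangent space of `ℚ_ε^n` at `x`, as a subset of `𝔼^{n+1}`. -/
def tangentSpaceForm (ε : SignType) {n : ℕ} (x : Flat n) : Set (Flat n) :=
  match ε with
  | .pos => {v | flatInner 1 x v = 0}
  | .neg => {v | flatInner (-1) x v = 0}
  | .zero => {v | v 0 = 0}

/-- The product `ℚ_ε^n × ℝ ⊆ 𝔼^{n+2}`. -/
def productSpace (ε : SignType) (n : ℕ) : Set (Flat n × ℝ) := {p | p.1 ∈ spaceForm ε n}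

/-- The unit vector field `∂/∂t` tangent to the second factor of `ℚ_ε^n × ℝ`. -/
def verticalField (n : ℕ) : Flat n × ℝ := (0, 1)

section Manifold

variable {E : Type*} [NormedAddCommGroup E] [NormedSpace ℝ E] {H : Type*} [TopologicalSpace H]
  (I : ModelWithCorners ℝ E H) {M : Type*} [TopologicalSpace M] [ChartedSpace H M]
  {V : Type*} [NormedAddCommGroup V] [NormedSpace ℝ V]

/-- The differential `f_*` at `x` of a map into a vector space. The tangent space `T_x M` is `E`,
through the preferred chart at `x`. -/
noncomputable def differential (f : M → V) (x : M) : E →L[ℝ] V := mfderiv I 𝓘(ℝ, V) f x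

/-- The flat derivative `D_X (f_* Y)` at `x`, where `Y` is extended to a vector field with constant
components in the preferred chart at `x` (for manifolds without boundary). -/
noncomputable def secondDerivative (f : M → V) (x : M) (X Y : E) : V :=
  fderiv ℝ (fderiv ℝ (f ∘ (extChartAt I x).symm)) (extChartAt I x x) X Y

/-- The normal space at `x` of a map `g` into `ℚ_ε^n`: the vectors tangent to `ℚ_ε^n` and
orthogonal to `g_* T_x N`. -/
def normalSpaceForm (ε : SignType) {n : ℕ} (g : M → Flat n) (x : M) : Set (Flat n) :=
  {ζ | ζ ∈ tangentSpaceForm ε (g x) ∧ ∀ X : E, flatInner ε (differential I g x X) ζ = 0}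

/-- The normal space at `x` of a map `f` into `ℚ_ε^n × ℝ`: the vectors tangent to `ℚ_ε^n × ℝ` and
orthogonal to `f_* T_x M`. -/
def normalProduct (ε : SignType) {n : ℕ} (f : M → Flat n × ℝ) (x : M) : Set (Flat n × ℝ) :=
  {ζ | ζ.1 ∈ tangentSpaceForm ε (f x).1 ∧
    ∀ X : E, flatInnerProd ε (differential I f x X) ζ = 0}

/-- `T` is the tangential part of `∂/∂t` along `f` at `x`, that is, `∂/∂t = f_* T + η` with `η`
normal. -/
def IsVerticalTangent (ε : SignType) {n : ℕ} (f : M → Flat n × ℝ) (x : M) (T : E) : Prop :=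
  verticalField n - differential I f x T ∈ normalProduct I ε f x

/-- `A` is the shape operator `A_ζ` at `x` of `f : M → ℚ_ε^n × ℝ` for the normal vector `ζ`, with
respect to the induced metric: `⟨A X, Y⟩ = ⟨α_f(X, Y), ζ⟩` for all `X, Y`.
The second fundamental form `α_f(X, Y)` is the component of `D_X (f_* Y)` normal to `f` and tangent
to `ℚ_ε^n × ℝ`; the other components are orthogonal to `ζ`, so that
`⟨α_f(X, Y), ζ⟩ = ⟨D_X (f_* Y), ζ⟩`. -/
def IsShapeOperator (ε : SignType) {n : ℕ} (f : M → Flat n × ℝ) (x : M) (ζ : Flat n × ℝ)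
    (A : E →ₗ[ℝ] E) : Prop :=
  ∀ X Y : E, flatInnerProd ε (differential I f x (A X)) (differential I f x Y) =
    flatInnerProd ε (secondDerivative I f x X Y) ζ

/-- Near `x`, `f` is a smooth map into `ℚ_ε^n × ℝ`; it is an immersion at `x`, and at `x` the
tangential part `T` of `∂/∂t` is an eigenvector (in particular nonzero) of all shape operators
of `f`. The domain carries the metric induced by `f`. -/
structure InClassAAt (ε : SignType) {n : ℕ} (f : M → Flat n × ℝ) (x : M) : Prop where
  smooth : ContMDiffAt I 𝓘(ℝ, Flat n × ℝ) ∞ f x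
  mem : ∀ᶠ y in 𝓝 x, f y ∈ productSpace ε n
  immersion : Function.Injective (differential I f x)
  eigenvector : ∃ T : E, IsVerticalTangent I ε f x T ∧ T ≠ 0 ∧
    ∀ ζ ∈ normalProduct I ε f x, ∃ A : E →ₗ[ℝ] E, IsShapeOperator I ε f x ζ A ∧
      ∃ c : ℝ, Module.End.HasEigenvector A c T

/-- `f` is an immersion into `ℚ_ε^n × ℝ` in class `𝒜`. -/
def InClassA (ε : SignType) {n : ℕ} (f : M → Flat n × ℝ) : Prop := ∀ x, InClassAAt I ε f x

/-- The data of a partial tube: a smooth immersion `g : N → ℚ_ε^n`, an orthonormal set of smooth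
parallel normal vector fields `ξ_1, …, ξ_k` along `g`, and a smooth regular curve
`α : J → ℚ_ε^k × ℝ`, on an open interval `J`, whose last component has nonvanishing derivative. -/
structure IsPartialTubeData (ε : SignType) {n k : ℕ} (g : M → Flat n) (ξ : Fin k → M → Flat n)
    (J : Set ℝ) (α : ℝ → Flat k × ℝ) : Prop where
  smooth_g : ContMDiff I 𝓘(ℝ, Flat n) ∞ g
  mem_g : ∀ x, g x ∈ spaceForm ε n
  immersion_g : ∀ x, Function.Injective (differential I g x)
  smooth_ξ : ∀ i, ContMDiff I 𝓘(ℝ, Flat n) ∞ (ξ i)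
  normal_ξ : ∀ i x, ξ i x ∈ normalSpaceForm I ε g x
  orthonormal_ξ : ∀ i j x, flatInner ε (ξ i x) (ξ j x) = if i = j then 1 else 0
  -- the derivative of `ξ_i` in any direction has no component in the normal space of `g`
  parallel_ξ : ∀ i x (X : E), ∀ ζ ∈ normalSpaceForm I ε g x,
    flatInner ε (differential I (ξ i) x X) ζ = 0
  isOpen_J : IsOpen J
  interval_J : J.OrdConnected
  smooth_α : ContDiffOn ℝ ∞ α J
  mem_α : ∀ s ∈ J, α s ∈ productSpace ε k
  regular_α : ∀ s ∈ J, deriv α s ≠ 0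
  deriv_last : ∀ s ∈ J, deriv (fun u => (α u).2) s ≠ 0

end Manifold

/-- The partial tube `(x, s) ↦ α_0(s) g(x) + ∑ α_i(s) ξ_i(x) + α_{k+1}(s) ∂/∂t`. -/
def partialTube {n k : ℕ} {N : Type*} (g : N → Flat n) (ξ : Fin k → N → Flat n)
    (α : ℝ → Flat k × ℝ) (q : N × ℝ) : Flat n × ℝ :=
  (α q.2).1 0 • ((g q.1, 0) : Flat n × ℝ) +
    ∑ i : Fin k, (α q.2).1 i.succ • ((ξ i q.1, 0) : Flat n × ℝ) +
    (α q.2).2 • verticalField n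

end ClassA

/-! Converse. `T` is the gradient of the height function `t`, so the eigenvector condition says that
`α_f(T, X) = 0` for all `X` tangent to the level sets of `t`. Write `f = (φ, t)` in coordinates
where each level set is a graph over one fixed vector space, and let `Y` be the multiple of `T` with
`dt(Y) = 1`. Then the condition sharpens to `D_Y (φ_* X) = 0` in the flat space, for every constant
`X` tangent to the level sets (`exists_characteristic_direction`): the tangent planes of the level
sets do not change along the integral curves of `T`.

These curves are straightened without solving an ODE. The functions `⟨φ_* X, φ - φ(z₀)⟩` are
constant along them, and together with `t` they form coordinates near `z₀`
(`exists_adapted_coordinates`). In these coordinates the map becomes `Φ(y, s)`; put `g = Φ(·, s₀)`.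
For a suitable function `a` of `s` alone, the sections `Φ(·, s) - a(s) g` are normal to `g` and have
derivatives tangent to `g`, so their mutual products are constant. By positivity they are
combinations, with coefficients depending on `s` only, of a finite orthonormal parallel frame
(`exists_orthonormal_combinations`), which is formula (1) (`IsAdapted.exists_tube`).

Direct part. As the `ξ_i` are parallel, `f_*(X, 0)` and its `s`-derivative both lie in `g_* TN`,
while the horizontal part of `f_* ∂_s` is orthogonal to `g_* TN`. At a regular point `f_*(TN × 0)`
fills `g_* TN` by dimension, so `∂_s` is orthogonal to the level sets for the metric and for the
second fundamental form. Hence it spans the line of `T`, and `T` is an eigenvector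
(`exists_vertical_eigenvector`). -/

namespace ClassA

/-! ### Linear algebra of the flat metric and of the tangent spaces of `ℚ_ε^n`. -/

section Algebra

variable {ε : SignType} {n : ℕ}

/-- The flat metric as a continuous bilinear map. -/
noncomputable def flatForm (ε : SignType) (n : ℕ) : Flat n →L[ℝ] Flat n →L[ℝ] ℝ :=
  LinearMap.toContinuousBilinearMap <| LinearMap.mk₂ ℝ (flatInner ε)
    (fun v v' w => by
      simp only [flatInner, Pi.add_apply, add_mul, Finset.sum_add_distrib]; ring)
    (fun c v w => by
      simp only [flatInner, Pi.smul_apply, smul_eq_mul, mul_add, Finset.mul_sum]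
      congr 1
      · ring
      · exact Finset.sum_congr rfl fun i _ => by ring)
    (fun v w w' => by
      simp only [flatInner, Pi.add_apply, mul_add, Finset.sum_add_distrib]; ring)
    (fun c v w => by
      simp only [flatInner, Pi.smul_apply, smul_eq_mul, mul_add, Finset.mul_sum]
      congr 1
      · ring
      · exact Finset.sum_congr rfl fun i _ => by ring)

theorem flatForm_apply (v w : Flat n) : flatForm ε n v w = flatInner ε v w := rfl

theorem flatForm_comm (v w : Flat n) : flatForm ε n v w = flatForm ε n w v := by
  simp only [flatForm_apply, flatInner, mul_comm]

theorem flatInnerProd_eq (v w : Flat n × ℝ) :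
    flatInnerProd ε v w = flatForm ε n v.1 w.1 + v.2 * w.2 := rfl

theorem mem_tangentSpaceForm_zero {x v : Flat n} : v ∈ tangentSpaceForm 0 x ↔ v 0 = 0 := Iff.rfl

theorem mem_tangentSpaceForm_of_ne_zero (hε : ε ≠ 0) {x v : Flat n} :
    v ∈ tangentSpaceForm ε x ↔ flatForm ε n x v = 0 := by
  match ε, hε with
  | .pos, _ => exact Iff.rfl
  | .neg, _ => exact Iff.rfl

theorem flatForm_self_of_mem_spaceForm (hε : ε ≠ 0) {x : Flat n} (hx : x ∈ spaceForm ε n) :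
    flatForm ε n x x = (ε : ℝ) := by
  match ε, hε with
  | .pos, _ => exact (show flatInner 1 x x = 1 from hx).trans (by simp)
  | .neg, _ => exact (show flatInner (-1) x x = -1 from hx.1).trans (by simp)

/-- The tangent space of `ℚ_ε^n` at `x`, as a subspace. -/
def tangentSubmodule (ε : SignType) {n : ℕ} (x : Flat n) : Submodule ℝ (Flat n) where
  carrier := tangentSpaceForm ε x
  add_mem' {v w} hv hw := by
    rcases eq_or_ne ε 0 with rfl | hε
    · rw [mem_tangentSpaceForm_zero] at *; simp [hv, hw]
    · rw [mem_tangentSpaceForm_of_ne_zero hε] at *; simp [hv, hw]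
  zero_mem' := by
    rcases eq_or_ne ε 0 with rfl | hε
    · rw [mem_tangentSpaceForm_zero]; rfl
    · rw [mem_tangentSpaceForm_of_ne_zero hε]; simp
  smul_mem' c v hv := by
    rcases eq_or_ne ε 0 with rfl | hε
    · rw [mem_tangentSpaceForm_zero] at *; simp [hv]
    · rw [mem_tangentSpaceForm_of_ne_zero hε] at *; simp [hv]

theorem eq_zero_of_head_tail {v : Flat n} (h0 : v 0 = 0)
    (h : ∑ i : Fin n, v i.succ * v i.succ = 0) : v = 0 := by
  have h' := (Finset.sum_eq_zero_iff_of_nonneg fun i _ => mul_self_nonneg (v i.succ)).1 h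
  funext j
  refine Fin.cases h0 (fun i => ?_) j
  exact mul_self_eq_zero.1 (h' i (Finset.mem_univ i))

/-- The metric of `ℚ_ε^n` is positive definite. -/
theorem flatForm_self_pos {x v : Flat n} (hx : x ∈ spaceForm ε n) (hv : v ∈ tangentSpaceForm ε x)
    (hv0 : v ≠ 0) : 0 < flatForm ε n v v := by
  have hs : 0 ≤ ∑ i : Fin n, v i.succ * v i.succ :=
    Finset.sum_nonneg fun i _ => mul_self_nonneg (v i.succ)
  by_cases hε : ε = -1
  · subst hε
    have hx' : flatInner (-1) x x = -1 ∧ 0 < x 0 := hx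
    have hv' : flatInner (-1) x v = 0 := hv
    have hcs := Finset.sum_mul_sq_le_sq_mul_sq Finset.univ
      (fun i : Fin n => x i.succ) (fun i : Fin n => v i.succ)
    simp only [flatInner, metricSign, if_true] at hx' hv'
    simp only [pow_two] at hcs
    simp only [flatForm_apply, flatInner, metricSign, if_true]
    set a := ∑ i : Fin n, x i.succ * x i.succ
    set b := ∑ i : Fin n, v i.succ * v i.succ with hb
    set c := ∑ i : Fin n, x i.succ * v i.succ
    -- Cauchy–Schwarz for the spatial parts now reads `(x₀ v₀)² ≤ (x₀² - 1) b`, that is, `x₀² (b -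
    -- v₀²) ≥ b`; it remains to see that `b > 0`.
    have hc : c = x 0 * v 0 := by linarith [hv']
    have ha : a = x 0 * x 0 - 1 := by linarith [hx'.1]
    have hbpos : 0 < b := by
      refine lt_of_le_of_ne hs fun hb0 => hv0 ?_
      rw [← hb0, hc] at hcs
      have h0 : x 0 * v 0 = 0 := by nlinarith [mul_self_nonneg (x 0 * v 0)]
      have : v 0 = 0 := (mul_eq_zero.1 h0).resolve_left hx'.2.ne'
      exact eq_zero_of_head_tail this (by rw [← hb, ← hb0])
    rw [hc, ha] at hcs
    have hx2 : 0 < x 0 * x 0 := mul_pos hx'.2 hx'.2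
    by_contra hcon
    push Not at hcon
    nlinarith [mul_nonneg hx2.le (by linarith : (0 : ℝ) ≤ v 0 * v 0 - b)]
  · simp only [flatForm_apply, flatInner, metricSign, if_neg hε, one_mul]
    refine lt_of_le_of_ne (add_nonneg (mul_self_nonneg _) hs) fun h => hv0 ?_
    have h0 : v 0 * v 0 = 0 := by linarith [mul_self_nonneg (v 0)]
    exact eq_zero_of_head_tail (mul_self_eq_zero.1 h0) (by linarith)

theorem eq_zero_of_flatForm_self {x v : Flat n} (hx : x ∈ spaceForm ε n)
    (hv : v ∈ tangentSpaceForm ε x) (h : flatForm ε n v v = 0) : v = 0 := by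
  by_contra h0
  exact (flatForm_self_pos hx hv h0).ne' h

theorem flatForm_self_nonneg {x v : Flat n} (hx : x ∈ spaceForm ε n)
    (hv : v ∈ tangentSpaceForm ε x) : 0 ≤ flatForm ε n v v := by
  by_cases h0 : v = 0
  · simp [h0]
  · exact (flatForm_self_pos hx hv h0).le

/-- Two unit timelike vectors, the first one future-pointing, have negative product if and only if
the second one is future-pointing as well. -/
theorem flatForm_neg_iff {x y : Flat n} (hx : x ∈ spaceForm (-1) n)
    (hy : flatForm (-1) n y y = -1) : flatForm (-1) n x y < 0 ↔ 0 < y 0 := by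
  have hx' : flatInner (-1) x x = -1 ∧ 0 < x 0 := hx
  have hcs := Finset.sum_mul_sq_le_sq_mul_sq Finset.univ
    (fun i : Fin n => x i.succ) (fun i : Fin n => y i.succ)
  have ha : 0 ≤ ∑ i : Fin n, x i.succ * x i.succ :=
    Finset.sum_nonneg fun i _ => mul_self_nonneg (x i.succ)
  have hb : 0 ≤ ∑ i : Fin n, y i.succ * y i.succ :=
    Finset.sum_nonneg fun i _ => mul_self_nonneg (y i.succ)
  simp only [flatInner, metricSign, if_true, flatForm_apply] at hx' hy ⊢
  obtain ⟨hx1, hx0⟩ := hx'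
  simp only [pow_two] at hcs
  set a := ∑ i : Fin n, x i.succ * x i.succ
  set b := ∑ i : Fin n, y i.succ * y i.succ
  set c := ∑ i : Fin n, x i.succ * y i.succ
  have ha' : a = x 0 * x 0 - 1 := by linarith
  have hb' : b = y 0 * y 0 - 1 := by linarith
  -- Both spatial norms are nonnegative, so `x₀² ≥ 1` and `y₀² ≥ 1`, which makes this strict. The
  -- sign of `-x₀ y₀ + c` is therefore that of `-x₀ y₀`.
  have hlt : c * c < (x 0 * y 0) * (x 0 * y 0) := by
    rw [ha', hb'] at hcs
    nlinarith
  have habs : |c| < |x 0 * y 0| := sq_lt_sq.1 (by simpa only [pow_two] using hlt)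
  constructor
  · intro h
    by_contra hy0
    push Not at hy0
    rw [abs_of_nonpos (mul_nonpos_of_nonneg_of_nonpos hx0.le hy0)] at habs
    linarith [neg_abs_le c]
  · intro h
    rw [abs_of_pos (mul_pos hx0 h)] at habs
    linarith [le_abs_self c]

theorem flatForm_linearCombination {S P : Type*} (σ : S → P → Flat n) {y z : P}
    (h : ∀ s t, flatForm ε n (σ s y) (σ t y) = flatForm ε n (σ s z) (σ t z)) (c d : S →₀ ℝ) :
    flatForm ε n (Finsupp.linearCombination ℝ (fun s => σ s y) c)
        (Finsupp.linearCombination ℝ (fun s => σ s y) d) =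
      flatForm ε n (Finsupp.linearCombination ℝ (fun s => σ s z) c)
        (Finsupp.linearCombination ℝ (fun s => σ s z) d) := by
  simp only [Finsupp.linearCombination_apply, Finsupp.sum, map_sum, _root_.sum_apply,
    map_smul, _root_.smul_apply, h]

/-- A subspace of a tangent space of `ℚ_ε^n` has an orthonormal basis. -/
theorem exists_orthonormal_spanning {x : Flat n} (hx : x ∈ spaceForm ε n)
    (V : Submodule ℝ (Flat n)) (hV : V ≤ tangentSubmodule ε x) :
    ∃ (k : ℕ) (e : Fin k → Flat n), (∀ i, e i ∈ V) ∧
      (∀ i j, flatForm ε n (e i) (e j) = if i = j then 1 else 0) ∧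
      ∀ v ∈ V, v = ∑ i, flatForm ε n v (e i) • e i := by
  let B : LinearMap.BilinForm ℝ V := LinearMap.mk₂ ℝ
    (fun v w => flatForm ε n (v : Flat n) (w : Flat n)) (by simp) (by simp) (by simp) (by simp)
  have hBs : LinearMap.IsSymm B := ⟨fun v w => flatForm_comm _ _⟩
  obtain ⟨v, hv⟩ := LinearMap.BilinForm.exists_orthogonal_basis hBs
  have hpos : ∀ i, 0 < flatForm ε n (v i : Flat n) (v i) := fun i =>
    flatForm_self_pos hx (hV (v i).2) fun h => v.ne_zero i (Subtype.ext h)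
  have hort : ∀ i j, i ≠ j → flatForm ε n (v i : Flat n) (v j) = 0 := fun i j hij => hv hij
  have hsq : ∀ i, (√(flatForm ε n (v i : Flat n) (v i)))⁻¹ *
      (√(flatForm ε n (v i : Flat n) (v i)))⁻¹ * flatForm ε n (v i : Flat n) (v i) = 1 := by
    intro i
    rw [← mul_inv, Real.mul_self_sqrt (hpos i).le, inv_mul_cancel₀ (hpos i).ne']
  refine ⟨_, fun i => (√(flatForm ε n (v i : Flat n) (v i)))⁻¹ • (v i : Flat n),
    fun i => V.smul_mem _ (v i).2, fun i j => ?_, fun w hw => ?_⟩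
  · split_ifs with h
    · subst h
      simpa [mul_assoc] using hsq i
    · simp [hort i j h]
  · have hrep := congrArg (Subtype.val) (v.sum_repr ⟨w, hw⟩)
    set c := v.repr ⟨w, hw⟩
    have hw' : w = ∑ i, c i • (v i : Flat n) := by
      simpa using hrep.symm
    have hcoef : ∀ i, flatForm ε n w (v i) = c i * flatForm ε n (v i : Flat n) (v i) := by
      intro i
      conv_lhs => rw [hw']
      simp only [map_sum, _root_.sum_apply, map_smul, _root_.smul_apply,
        smul_eq_mul]
      rw [Finset.sum_eq_single i (fun j _ hj => by rw [hort j i hj, mul_zero]) (by simp)]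
    conv_lhs => rw [hw']
    refine Finset.sum_congr rfl fun i _ => ?_
    rw [map_smul, hcoef, smul_smul, smul_eq_mul]
    congr 1
    linear_combination -(c i) * hsq i

/-- A family of sections with constant Gram matrix is spanned, with constant coefficients, by an
orthonormal family of sections which are constant combinations of the given ones. -/
theorem exists_orthonormal_combinations {S P : Type*} (σ : S → P → Flat n) (g : P → Flat n)
    (hg : ∀ y, g y ∈ spaceForm ε n) (hσ : ∀ s y, σ s y ∈ tangentSpaceForm ε (g y)) (z : P)
    (h : ∀ s t y, flatForm ε n (σ s y) (σ t y) = flatForm ε n (σ s z) (σ t z)) :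
    ∃ (k : ℕ) (c : Fin k → S →₀ ℝ),
      (∀ i j y, flatForm ε n (Finsupp.linearCombination ℝ (fun s => σ s y) (c i))
        (Finsupp.linearCombination ℝ (fun s => σ s y) (c j)) = if i = j then 1 else 0) ∧
      ∀ s y, σ s y = ∑ i, flatForm ε n (σ s z)
          (Finsupp.linearCombination ℝ (fun s => σ s z) (c i)) •
        Finsupp.linearCombination ℝ (fun s => σ s y) (c i) := by
  obtain ⟨k, e, heV, heo, hes⟩ := exists_orthonormal_spanning (hg z)
    (Submodule.span ℝ (Set.range fun s => σ s z))
    (Submodule.span_le.2 (by rintro _ ⟨s, rfl⟩; exact hσ s z))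
  choose c hc using fun i => (Finsupp.mem_span_range_iff_exists_finsupp.1 (heV i))
  have hc' : ∀ i, Finsupp.linearCombination ℝ (fun s => σ s z) (c i) = e i := fun i => by
    rw [Finsupp.linearCombination_apply]; exact hc i
  refine ⟨k, c, fun i j y => ?_, fun s y => ?_⟩
  · rw [flatForm_linearCombination σ (fun s t => h s t y), hc', hc', heo]
  · simp only [hc']
    -- `d` is a linear relation among the sections at `z`. The square of the combination it defines
    -- does not depend on the point, so by positivity the relation holds at every `y`.
    let d : S →₀ ℝ := Finsupp.single s 1 - ∑ i, flatForm ε n (σ s z) (e i) • c i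
    have hd : ∀ y, Finsupp.linearCombination ℝ (fun s => σ s y) d = σ s y -
        ∑ i, flatForm ε n (σ s z) (e i) • Finsupp.linearCombination ℝ (fun s => σ s y) (c i) := by
      intro y
      simp [d, map_sub, map_sum]
    have hdz : Finsupp.linearCombination ℝ (fun s => σ s z) d = 0 := by
      rw [hd, sub_eq_zero]
      simp only [hc']
      exact hes _ (Submodule.subset_span ⟨s, rfl⟩)
    have htan : Finsupp.linearCombination ℝ (fun s => σ s y) d ∈ tangentSubmodule ε (g y) := by
      rw [Finsupp.linearCombination_apply]
      exact Submodule.sum_mem _ fun t _ => Submodule.smul_mem _ _ (hσ t y)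
    have h0 := eq_zero_of_flatForm_self (hg y) htan (by
      rw [flatForm_linearCombination σ (fun s t => h s t y), hdz]; simp)
    rw [hd, sub_eq_zero] at h0
    exact h0

variable {E : Type*} [AddCommGroup E] [Module ℝ E] [FiniteDimensional ℝ E]

/-- An anisotropic bilinear form on a finite-dimensional space represents all functionals. -/
theorem exists_riesz_equiv (B : E →ₗ[ℝ] E →ₗ[ℝ] ℝ) (hB : ∀ X, B X X = 0 → X = 0) :
    ∃ R : (E →ₗ[ℝ] ℝ) ≃ₗ[ℝ] E, ∀ l X, B (R l) X = l X := by
  have hinj : Function.Injective B := by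
    rw [← LinearMap.ker_eq_bot, LinearMap.ker_eq_bot']
    exact fun X hX => hB X (by simp [hX])
  refine ⟨(LinearEquiv.ofInjectiveOfFinrankEq B hinj
    (Subspace.dual_finrank_eq (K := ℝ) (V := E)).symm).symm, fun l X => ?_⟩
  have := (LinearEquiv.ofInjectiveOfFinrankEq B hinj
    (Subspace.dual_finrank_eq (K := ℝ) (V := E)).symm).apply_symm_apply l
  exact congrArg (fun m => m X) this

/-- A vector tangent to `ℚ_ε^n` and orthogonal to the normal space of a subspace of the tangent
space belongs to that subspace. -/
theorem mem_range_of_orthogonal {x : Flat n} (hx : x ∈ spaceForm ε n) (L : E →ₗ[ℝ] Flat n)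
    (hinj : Function.Injective L) (hL : ∀ X, L X ∈ tangentSpaceForm ε x) {v : Flat n}
    (hv : v ∈ tangentSpaceForm ε x)
    (h : ∀ ζ ∈ tangentSpaceForm ε x, (∀ X, flatForm ε n (L X) ζ = 0) → flatForm ε n v ζ = 0) :
    ∃ X, L X = v := by
  let B : E →ₗ[ℝ] E →ₗ[ℝ] ℝ := LinearMap.mk₂ ℝ (fun X Y => flatForm ε n (L X) (L Y))
    (by simp) (by simp) (by simp) (by simp)
  obtain ⟨R, hR⟩ := exists_riesz_equiv B fun X hX =>
    hinj ((eq_zero_of_flatForm_self hx (hL X) hX).trans (map_zero L).symm)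
  -- `L (R l)` is the orthogonal projection of `v` to the range; the remainder is normal to the
  -- range, hence orthogonal to `v` and to itself.
  let l : E →ₗ[ℝ] ℝ := (flatForm ε n v).toLinearMap ∘ₗ L
  refine ⟨R l, ?_⟩
  have hort : ∀ X, flatForm ε n (L X) (v - L (R l)) = 0 := fun X => by
    have h1 : flatForm ε n (L (R l)) (L X) = flatForm ε n v (L X) := hR l X
    rw [map_sub, flatForm_comm, ← h1, flatForm_comm (L X), sub_self]
  have htan : v - L (R l) ∈ tangentSpaceForm ε x :=
    (tangentSubmodule ε x).sub_mem hv (hL _)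
  have h0 := eq_zero_of_flatForm_self hx htan (by
    rw [map_sub, flatForm_comm, h _ htan hort, flatForm_comm, hort, sub_zero])
  exact (sub_eq_zero.1 h0).symm

end Algebra

/-! ### Calculus in the flat space and a coordinate form of class `𝒜`. -/

section Calculus

variable {ε : SignType} {n : ℕ} {V W U : Type*} [NormedAddCommGroup V] [NormedSpace ℝ V]
  [NormedAddCommGroup W] [NormedSpace ℝ W] [NormedAddCommGroup U] [NormedSpace ℝ U]

theorem fderiv_flatForm {u v : V → Flat n} {z : V} (hu : DifferentiableAt ℝ u z)
    (hv : DifferentiableAt ℝ v z) (X : V) :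
    fderiv ℝ (fun y => flatForm ε n (u y) (v y)) z X =
      flatForm ε n (fderiv ℝ u z X) (v z) + flatForm ε n (u z) (fderiv ℝ v z X) := by
  rw [((flatForm ε n).hasFDerivAt_of_bilinear hu.hasFDerivAt hv.hasFDerivAt).fderiv]
  simp [ContinuousLinearMap.precompR, ContinuousLinearMap.precompL, add_comm]

theorem fderiv_coord {u : V → Flat n} {z : V} (hu : DifferentiableAt ℝ u z) (X : V)
    (i : Fin (n + 1)) : fderiv ℝ (fun y => u y i) z X = fderiv ℝ u z X i := by
  rw [(hasFDerivAt_pi'.1 hu.hasFDerivAt i).fderiv]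
  rfl

/-- The differential of a map into `ℚ_ε^n` takes values in the tangent space. -/
theorem fderiv_mem_tangentSpaceForm {u : V → Flat n} {z : V} (hu : DifferentiableAt ℝ u z)
    (hmem : ∀ᶠ y in 𝓝 z, u y ∈ spaceForm ε n) (X : V) :
    fderiv ℝ u z X ∈ tangentSpaceForm ε (u z) := by
  rcases eq_or_ne ε 0 with rfl | hε
  · have h : (fun y => u y 0) =ᶠ[𝓝 z] fun _ => 1 := hmem
    rw [mem_tangentSpaceForm_zero, ← fderiv_coord hu, h.fderiv_eq]
    simp
  · have h : (fun y => flatForm ε n (u y) (u y)) =ᶠ[𝓝 z] fun _ => (ε : ℝ) :=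
      hmem.mono fun y hy => flatForm_self_of_mem_spaceForm hε hy
    have h2 := fderiv_flatForm (ε := ε) hu hu X
    rw [h.fderiv_eq, flatForm_comm (fderiv ℝ u z X)] at h2
    rw [mem_tangentSpaceForm_of_ne_zero hε]
    simp at h2
    linarith

theorem differentiableAt_fderiv {u : V → W} {z : V} (hu : ContDiffAt ℝ ∞ u z) :
    DifferentiableAt ℝ (fderiv ℝ u) z :=
  (hu.fderiv_right (m := ∞) le_rfl).differentiableAt (by simp)

theorem fderiv_fderiv_apply {u : V → W} {z : V} (hu : ContDiffAt ℝ ∞ u z) (X Y : V) :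
    fderiv ℝ (fun y => fderiv ℝ u y Y) z X = fderiv ℝ (fderiv ℝ u) z X Y := by
  rw [fderiv_clm_apply (differentiableAt_fderiv hu) (differentiableAt_const _)]
  simp

theorem differentiableAt_fderiv_apply {u : V → W} {z : V} (hu : ContDiffAt ℝ ∞ u z) (Y : V) :
    DifferentiableAt ℝ (fun y => fderiv ℝ u y Y) z :=
  (differentiableAt_fderiv hu).clm_apply (differentiableAt_const _)

theorem fderiv_fderiv_comp {G : W → U} {τ : V → W} {z : V} (hG : ContDiffAt ℝ ∞ G (τ z))
    (hτ : ContDiffAt ℝ ∞ τ z) (X Y : V) :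
    fderiv ℝ (fderiv ℝ (G ∘ τ)) z X Y =
      fderiv ℝ (fderiv ℝ G) (τ z) (fderiv ℝ τ z X) (fderiv ℝ τ z Y) +
        fderiv ℝ G (τ z) (fderiv ℝ (fderiv ℝ τ) z X Y) := by
  have hd := differentiableAt_fderiv hG
  have hτd := hτ.differentiableAt (by simp)
  have hev : (fun y => fderiv ℝ (G ∘ τ) y Y) =ᶠ[𝓝 z]
      fun y => fderiv ℝ G (τ y) (fderiv ℝ τ y Y) := by
    have h1 : ∀ᶠ y in 𝓝 z, ContDiffAt ℝ 1 G (τ y) :=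
      hτ.continuousAt.eventually ((hG.of_le (m := 1) (by simp)).eventually (by simp))
    have h2 : ∀ᶠ y in 𝓝 z, ContDiffAt ℝ 1 τ y := (hτ.of_le (m := 1) (by simp)).eventually (by simp)
    filter_upwards [h1, h2] with y hy1 hy2
    rw [fderiv_comp y (hy1.differentiableAt (by simp)) (hy2.differentiableAt (by simp))]
    rfl
  rw [← fderiv_fderiv_apply (hG.comp z hτ), hev.fderiv_eq,
    fderiv_clm_apply (c := fun y => fderiv ℝ G (τ y)) (hd.comp z hτd)
      (differentiableAt_fderiv_apply hτ Y)]
  have h3 : fderiv ℝ (fun y => fderiv ℝ G (τ y)) z = (fderiv ℝ (fderiv ℝ G) (τ z)).comp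
      (fderiv ℝ τ z) := fderiv_comp z hd hτd
  simp [h3, fderiv_fderiv_apply hτ, add_comm]

/-- A smooth map between spaces of the same dimension with injective differential at a point
restricts to a diffeomorphism near that point. -/
theorem exists_openPartialHomeomorph_of_injective [FiniteDimensional ℝ V] [FiniteDimensional ℝ W]
    (hdim : Module.finrank ℝ V = Module.finrank ℝ W) {u : V → W} {Ω : Set V} (hΩ : IsOpen Ω)
    (hu : ContDiffOn ℝ ∞ u Ω) {a : V} (ha : a ∈ Ω) (hinj : Function.Injective (fderiv ℝ u a)) :
    ∃ e : OpenPartialHomeomorph V W, a ∈ e.source ∧ e.source ⊆ Ω ∧ ⇑e = u ∧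
      (∀ z ∈ e.source, Function.Injective (fderiv ℝ u z)) ∧ ContDiffOn ℝ ∞ e.symm e.target := by
  have : CompleteSpace V := FiniteDimensional.complete ℝ V
  have hequiv : ∀ z, Function.Injective (fderiv ℝ u z) →
      ∃ A : V ≃L[ℝ] W, (A : V →L[ℝ] W) = fderiv ℝ u z := fun z hz =>
    ⟨(LinearEquiv.ofInjectiveOfFinrankEq (fderiv ℝ u z).toLinearMap hz
      hdim).toContinuousLinearEquiv, by ext; rfl⟩
  have hcd : ∀ z ∈ Ω, ContDiffAt ℝ ∞ u z := fun z hz => hu.contDiffAt (hΩ.mem_nhds hz)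
  obtain ⟨A, hA⟩ := hequiv a hinj
  have hua : HasFDerivAt u (A : V →L[ℝ] W) a := by
    rw [hA]; exact ((hcd a ha).differentiableAt (by simp)).hasFDerivAt
  let e₀ := (hcd a ha).toOpenPartialHomeomorph u hua (by simp)
  -- The source is shrunk so that the differential is invertible at each of its points, not only at
  -- `a`; this gives smoothness of the inverse on the whole target.
  let Ω' := Ω ∩ fderiv ℝ u ⁻¹' {L | Function.Injective L}
  have hΩ' : IsOpen Ω' := (hu.continuousOn_fderiv_of_isOpen hΩ (by simp)).isOpen_inter_preimage hΩ
    ContinuousLinearMap.isOpen_injective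
  have hsource : (e₀.restrOpen Ω' hΩ').source = e₀.source ∩ Ω' := e₀.restrOpen_source Ω' hΩ'
  refine ⟨e₀.restrOpen Ω' hΩ', ?_, ?_, rfl, ?_, ?_⟩
  · rw [hsource]
    exact ⟨(hcd a ha).mem_toOpenPartialHomeomorph_source hua (by simp), ha, hinj⟩
  · rw [hsource]; exact fun z hz => hz.2.1
  · rw [hsource]; exact fun z hz => hz.2.2
  · intro w hw
    have hz := (e₀.restrOpen Ω' hΩ').map_target hw
    rw [hsource] at hz
    obtain ⟨B, hB⟩ := hequiv _ hz.2.2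
    refine ((e₀.restrOpen Ω' hΩ').contDiffAt_symm hw (f₀' := B) ?_ ?_).contDiffWithinAt
    · rw [hB]
      exact ((hcd _ hz.2.1).differentiableAt (by simp)).hasFDerivAt
    · exact hcd _ hz.2.1

/-- The condition defining class `𝒜`, for a map on an open set of a vector space. The condition on
the shape operators is expressed by the second fundamental form. -/
def IsClassAImmersionAt (ε : SignType) (F : V → Flat n × ℝ) (z : V) : Prop :=
  Function.Injective (fderiv ℝ F z) ∧
  ∃ T : V, T ≠ 0 ∧
    (∀ X, flatInnerProd ε (fderiv ℝ F z X) (verticalField n - fderiv ℝ F z T) = 0) ∧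
    ∀ ζ : Flat n × ℝ, ζ.1 ∈ tangentSpaceForm ε (F z).1 →
      (∀ X, flatInnerProd ε (fderiv ℝ F z X) ζ = 0) →
      ∀ Y, flatInnerProd ε (fderiv ℝ F z T) (fderiv ℝ F z Y) = 0 →
        flatInnerProd ε (fderiv ℝ (fderiv ℝ F) z T Y) ζ = 0

theorem IsClassAImmersionAt.congr {F G : V → Flat n × ℝ} {z : V}
    (hF : IsClassAImmersionAt ε F z) (h : F =ᶠ[𝓝 z] G) : IsClassAImmersionAt ε G z := by
  have h1 := h.fderiv_eq (𝕜 := ℝ)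
  have h2 := (h.fderiv (𝕜 := ℝ)).fderiv_eq (𝕜 := ℝ)
  unfold IsClassAImmersionAt at *
  rwa [h1, h2, h.eq_of_nhds] at hF

/-- Second derivatives are not tensorial, but the extra term in the chain rule lies in the range of
the differential of `G` and is killed by every normal `ζ`. -/
theorem IsClassAImmersionAt.of_comp {G : W → Flat n × ℝ} {τ : V → W} {z : V}
    (h : IsClassAImmersionAt ε (G ∘ τ) z) (hG : ContDiffAt ℝ ∞ G (τ z))
    (hτ : ContDiffAt ℝ ∞ τ z) (hbij : Function.Bijective (fderiv ℝ τ z)) :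
    IsClassAImmersionAt ε G (τ z) := by
  have h1 : ∀ X, fderiv ℝ (G ∘ τ) z X = fderiv ℝ G (τ z) (fderiv ℝ τ z X) := fun X => by
    rw [fderiv_comp z (hG.differentiableAt (by simp)) (hτ.differentiableAt (by simp))]; rfl
  obtain ⟨hinj, T, hT0, hT, hA⟩ := h
  simp only [h1] at hT hA
  refine ⟨fun X Y hXY => ?_, fderiv ℝ τ z T, fun h0 => hT0 (hbij.1 (h0.trans (map_zero _).symm)),
    fun X => ?_, fun ζ hζ hζn Y hY => ?_⟩
  · obtain ⟨X, rfl⟩ := hbij.2 X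
    obtain ⟨Y, rfl⟩ := hbij.2 Y
    rw [← h1, ← h1] at hXY
    rw [hinj hXY]
  · obtain ⟨X, rfl⟩ := hbij.2 X
    exact hT X
  · obtain ⟨Y, rfl⟩ := hbij.2 Y
    have h2 := hA ζ hζ (fun X => hζn _) Y hY
    rw [fderiv_fderiv_comp hG hτ, flatInnerProd_eq, Prod.fst_add, Prod.snd_add, map_add] at h2
    have h3 := hζn (fderiv ℝ (fderiv ℝ τ) z T Y)
    rw [flatInnerProd_eq] at h3 ⊢
    simp only [_root_.add_apply] at h2
    linarith

end Calculus

/-! ### Passage from the manifold to coordinates. -/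

section Chart

variable {ε : SignType} {n : ℕ} {E : Type*} [NormedAddCommGroup E] [NormedSpace ℝ E]
  {H : Type*} [TopologicalSpace H] {I : ModelWithCorners ℝ E H} [I.Boundaryless]
  {M : Type*} [TopologicalSpace M] [ChartedSpace H M]
  {V : Type*} [NormedAddCommGroup V] [NormedSpace ℝ V]

theorem differential_eq_fderiv {f : M → V} {x : M} (hf : MDifferentiableAt I 𝓘(ℝ, V) f x) :
    differential I f x = fderiv ℝ (f ∘ (extChartAt I x).symm) (extChartAt I x x) := by
  rw [differential, hf.mfderiv, I.range_eq_univ, fderivWithin_univ]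
  rfl

/-- If `A_ζ T = c T`, then `⟨α_f(T, Y), ζ⟩ = c ⟨T, Y⟩`, which vanishes for `Y` orthogonal to `T`. -/
theorem InClassAAt.isClassAImmersionAt {f : M → Flat n × ℝ} {x : M} (h : InClassAAt I ε f x) :
    IsClassAImmersionAt ε (f ∘ (extChartAt I x).symm) (extChartAt I x x) := by
  have hd := differential_eq_fderiv (h.smooth.mdifferentiableAt (by simp))
  obtain ⟨T, hT, hT0, hA⟩ := h.eigenvector
  have himm := h.immersion
  simp only [IsVerticalTangent, normalProduct, IsShapeOperator, Set.mem_ofPred_eq,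
    secondDerivative, hd] at hT hA himm
  refine ⟨himm, T, hT0, hT.2, fun ζ hζ hζn Y hY => ?_⟩
  rw [Function.comp_apply, extChartAt_to_inv] at hζ
  obtain ⟨A, hAs, c, hc⟩ := hA ζ ⟨hζ, hζn⟩
  rw [← hAs, hc.apply_eq_smul, map_smul, flatInnerProd_eq, Prod.smul_fst, Prod.smul_snd, map_smul]
  rw [flatInnerProd_eq] at hY
  simp only [_root_.smul_apply, smul_eq_mul]
  linear_combination c * hY

variable [IsManifold I ∞ M]

/-- The condition defining class `𝒜` in an arbitrary local coordinate system. -/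
theorem InClassAAt.of_coordinates {f : M → Flat n × ℝ} (e : OpenPartialHomeomorph M V)
    (he : ContMDiffOn I 𝓘(ℝ, V) ∞ e e.source) (he' : ContMDiffOn 𝓘(ℝ, V) I ∞ e.symm e.target)
    {x : M} (hx : x ∈ e.source) (h : InClassAAt I ε f x) :
    IsClassAImmersionAt ε (f ∘ e.symm) (e x) := by
  set c := extChartAt I x
  let τ : E → V := e ∘ c.symm
  let ρ : V → E := c ∘ e.symm
  have hcx : c.symm (c x) = x := extChartAt_to_inv x
  have hex : e.symm (e x) = x := e.left_inv hx
  have hτx : τ (c x) = e x := by simp only [τ, Function.comp_apply, hcx]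
  have hρx : ρ (e x) = c x := by simp only [ρ, Function.comp_apply, hex]
  have hes : e.source ∈ 𝓝 x := e.open_source.mem_nhds hx
  have het : e.target ∈ 𝓝 (e x) := e.open_target.mem_nhds (e.map_source hx)
  have hcs : ContMDiffAt 𝓘(ℝ, E) I ∞ c.symm (c x) :=
    (contMDiffOn_extChartAt_symm x).contMDiffAt (extChartAt_target_mem_nhds x)
  have hcd : ContMDiffAt I 𝓘(ℝ, E) ∞ c x := contMDiffAt_extChartAt
  have hed : ContMDiffAt I 𝓘(ℝ, V) ∞ e x := he.contMDiffAt hes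
  have hesd : ContMDiffAt 𝓘(ℝ, V) I ∞ e.symm (e x) := he'.contMDiffAt het
  have hτ : ContDiffAt ℝ ∞ τ (c x) := contMDiffAt_iff_contDiffAt.1
    (ContMDiffAt.comp (c x) (by rwa [hcx]) hcs)
  have hρ : ContDiffAt ℝ ∞ ρ (e x) := contMDiffAt_iff_contDiffAt.1
    (ContMDiffAt.comp (e x) (by rwa [hex]) hesd)
  have hG : ContDiffAt ℝ ∞ (f ∘ e.symm) (e x) := contMDiffAt_iff_contDiffAt.1
    (ContMDiffAt.comp (e x) (by rw [hex]; exact h.smooth) hesd)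
  have hcsm : ∀ᶠ z in 𝓝 (c x), c.symm z ∈ e.source :=
    hcs.continuousAt.eventually (by rw [hcx]; exact hes)
  have hesm : ∀ᶠ w in 𝓝 (e x), e.symm w ∈ c.source :=
    hesd.continuousAt.eventually (by rw [hex]; exact extChartAt_source_mem_nhds x)
  have hρτ : ρ ∘ τ =ᶠ[𝓝 (c x)] id := by
    filter_upwards [hcsm, extChartAt_target_mem_nhds (I := I) x] with z hz hz'
    simp only [ρ, τ, Function.comp_apply, e.left_inv hz, id]
    exact c.right_inv hz'
  have hτρ : τ ∘ ρ =ᶠ[𝓝 (e x)] id := by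
    filter_upwards [hesm, het] with w hw hw'
    simp only [ρ, τ, Function.comp_apply, c.left_inv hw, id, e.right_inv hw']
  have h1 : (fderiv ℝ ρ (e x)).comp (fderiv ℝ τ (c x)) = ContinuousLinearMap.id ℝ E := by
    rw [← fderiv_id (x := c x), ← hρτ.fderiv_eq, fderiv_comp _ _ (hτ.differentiableAt (by simp)),
      hτx]
    rw [hτx]; exact hρ.differentiableAt (by simp)
  have h2 : (fderiv ℝ τ (c x)).comp (fderiv ℝ ρ (e x)) = ContinuousLinearMap.id ℝ V := by
    rw [← fderiv_id (x := e x), ← hτρ.fderiv_eq, fderiv_comp _ _ (hρ.differentiableAt (by simp)),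
      hρx]
    rw [hρx]; exact hτ.differentiableAt (by simp)
  have hfe : f ∘ c.symm =ᶠ[𝓝 (c x)] (f ∘ e.symm) ∘ τ := by
    filter_upwards [hcsm] with z hz
    simp only [τ, Function.comp_apply, e.left_inv hz]
  have hmain := (h.isClassAImmersionAt.congr hfe).of_comp (by rwa [hτx]) hτ
    ⟨Function.LeftInverse.injective (g := fderiv ℝ ρ (e x)) fun X => DFunLike.congr_fun h1 X,
     Function.RightInverse.surjective (g := fderiv ℝ ρ (e x)) fun X => DFunLike.congr_fun h2 X⟩
  rwa [hτx] at hmain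

end Chart

/-! ### Characteristic directions and the coordinates that straighten them. -/

section Local

variable {ε : SignType} {n : ℕ} {E : Type*} [NormedAddCommGroup E] [NormedSpace ℝ E]

theorem eventually_differentiableAt {V W : Type*} [NormedAddCommGroup V] [NormedSpace ℝ V]
    [NormedAddCommGroup W] [NormedSpace ℝ W] {u : V → W} {z : V} (hu : ContDiffAt ℝ ∞ u z) :
    ∀ᶠ w in 𝓝 z, DifferentiableAt ℝ u w :=
  ((hu.of_le (m := 1) (by simp)).eventually (by simp)).mono fun _ h =>
    h.differentiableAt (by simp)

theorem fderiv_graph {φ : E × ℝ → Flat n} {z : E × ℝ} (hφ : DifferentiableAt ℝ φ z)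
    (X : E × ℝ) : fderiv ℝ (fun w => (φ w, w.2)) z X = (fderiv ℝ φ z X, X.2) := by
  rw [(hφ.hasFDerivAt.prodMk hasFDerivAt_snd).fderiv]
  rfl

theorem fderiv_fderiv_graph {φ : E × ℝ → Flat n} {z : E × ℝ} (hφ : ContDiffAt ℝ ∞ φ z)
    (X Y : E × ℝ) : fderiv ℝ (fderiv ℝ (fun w => (φ w, w.2))) z X Y =
      (fderiv ℝ (fderiv ℝ φ) z X Y, 0) := by
  have hev : (fun w => fderiv ℝ (fun w => (φ w, w.2)) w Y) =ᶠ[𝓝 z]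
      fun w => (fderiv ℝ φ w Y, Y.2) := by
    filter_upwards [eventually_differentiableAt hφ] with w hw using fderiv_graph hw Y
  rw [← fderiv_fderiv_apply (hφ.prodMk contDiffAt_snd), hev.fderiv_eq,
    ((differentiableAt_fderiv_apply hφ Y).hasFDerivAt.prodMk (hasFDerivAt_const Y.2 z)).fderiv,
    ← fderiv_fderiv_apply hφ]
  rfl

/-- The derivative of a vector field `w` tangent to `ℚ_ε^n` along `u` has no component normal to
`ℚ_ε^n` in the directions orthogonal to `w`. -/
theorem fderiv_section_mem_tangentSpaceForm {V : Type*} [NormedAddCommGroup V] [NormedSpace ℝ V]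
    {u w : V → Flat n} {z : V} (hu : DifferentiableAt ℝ u z) (hw : DifferentiableAt ℝ w z)
    (htan : ∀ᶠ y in 𝓝 z, w y ∈ tangentSpaceForm ε (u y)) {X : V}
    (h : flatForm ε n (fderiv ℝ u z X) (w z) = 0) :
    fderiv ℝ w z X ∈ tangentSpaceForm ε (u z) := by
  rcases eq_or_ne ε 0 with rfl | hε
  · have h0 : (fun y => w y 0) =ᶠ[𝓝 z] fun _ => 0 := htan
    rw [mem_tangentSpaceForm_zero, ← fderiv_coord hw, h0.fderiv_eq]
    simp
  · have h0 : (fun y => flatForm ε n (u y) (w y)) =ᶠ[𝓝 z] fun _ => 0 :=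
      htan.mono fun y hy => (mem_tangentSpaceForm_of_ne_zero hε).1 hy
    have h1 := fderiv_flatForm (ε := ε) hu hw X
    rw [h0.fderiv_eq, h, zero_add] at h1
    rw [mem_tangentSpaceForm_of_ne_zero hε, ← h1]
    simp

theorem fderiv_fderiv_mem_tangentSpaceForm {V : Type*} [NormedAddCommGroup V] [NormedSpace ℝ V]
    {φ : V → Flat n} {z : V} (hφ : ContDiffAt ℝ ∞ φ z)
    (hmem : ∀ᶠ w in 𝓝 z, φ w ∈ spaceForm ε n) {X Y : V}
    (h : flatForm ε n (fderiv ℝ φ z X) (fderiv ℝ φ z Y) = 0) :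
    fderiv ℝ (fderiv ℝ φ) z X Y ∈ tangentSpaceForm ε (φ z) := by
  rw [← fderiv_fderiv_apply hφ]
  refine fderiv_section_mem_tangentSpaceForm (hφ.differentiableAt (by simp))
    (differentiableAt_fderiv_apply hφ Y) ?_ h
  filter_upwards [hmem.eventually_nhds, eventually_differentiableAt hφ] with w h1 h2
    using fderiv_mem_tangentSpaceForm h2 h1 Y

theorem map_fderiv_eq_fst {φ : E × ℝ → Flat n} {z : E × ℝ} {π : Flat n →L[ℝ] E}
    (hφ : DifferentiableAt ℝ φ z) (hπ : ∀ᶠ w in 𝓝 z, π (φ w) = w.1) (X : E × ℝ) :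
    π (fderiv ℝ φ z X) = X.1 := by
  have h1 : π ∘ φ =ᶠ[𝓝 z] Prod.fst := hπ
  have h2 := h1.fderiv_eq (𝕜 := ℝ)
  rw [(π.hasFDerivAt.comp z hφ.hasFDerivAt).fderiv, fderiv_fst] at h2
  exact DFunLike.congr_fun h2 X

/-- In class `𝒜`, for a map in graph form over the tangent space, the tangent planes of the level
sets of the height function are parallel along a direction transversal to the level sets. -/
theorem exists_characteristic_direction [FiniteDimensional ℝ E] {φ : E × ℝ → Flat n}
    {z : E × ℝ} {π : Flat n →L[ℝ] E} (hφ : ContDiffAt ℝ ∞ φ z)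
    (hmem : ∀ᶠ w in 𝓝 z, φ w ∈ spaceForm ε n) (hπ : ∀ᶠ w in 𝓝 z, π (φ w) = w.1)
    (hA : IsClassAImmersionAt ε (fun w => (φ w, w.2)) z) :
    ∃ Y : E, ∀ X : E, flatForm ε n (fderiv ℝ φ z (Y, 1)) (fderiv ℝ φ z (X, 0)) = 0 ∧
      fderiv ℝ (fderiv ℝ φ) z (Y, 1) (X, 0) = 0 := by
  have hφd := hφ.differentiableAt (by simp)
  have hφz := hmem.self_of_nhds
  have hπd : ∀ᶠ w in 𝓝 z, ∀ X, π (fderiv ℝ φ w X) = X.1 := by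
    filter_upwards [hπ.eventually_nhds, eventually_differentiableAt hφ] with w h1 h2 X
    exact map_fderiv_eq_fst h2 h1 X
  -- The map `π ∘ φ` is linear in the coordinates, so `π` kills all second derivatives of `φ`.
  have hπdd : ∀ X Y, π (fderiv ℝ (fderiv ℝ φ) z X Y) = 0 := fun X Y => by
    have h3 : (π ∘ fun w => fderiv ℝ φ w Y) =ᶠ[𝓝 z] fun _ => Y.1 := hπd.mono fun w hw => hw Y
    have h4 := h3.fderiv_eq (𝕜 := ℝ)
    rw [(π.hasFDerivAt.comp z (differentiableAt_fderiv_apply hφ Y).hasFDerivAt).fderiv] at h4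
    have h5 := DFunLike.congr_fun h4 X
    rw [← fderiv_fderiv_apply hφ]
    simpa using h5
  obtain ⟨-, T, hT0, hT, hA⟩ := hA
  simp only [fderiv_graph hφd, flatInnerProd_eq, fderiv_fderiv_graph hφ, verticalField,
    Prod.fst_sub, Prod.snd_sub, zero_sub, zero_mul, add_zero] at hT hA
  have htan : ∀ X, fderiv ℝ φ z X ∈ tangentSpaceForm ε (φ z) :=
    fderiv_mem_tangentSpaceForm hφd hmem
  -- If `T` were tangent to the level set, pairing the defining relation of `T` with `T` itself
  -- would give `φ_* T = 0`.
  have ha : T.2 ≠ 0 := by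
    intro ha
    have h1 := hT T
    rw [ha, map_neg] at h1
    have h2 := eq_zero_of_flatForm_self hφz (htan T) (by linarith)
    have h3 := hπd.self_of_nhds T
    rw [h2, map_zero] at h3
    exact hT0 (Prod.ext h3.symm ha)
  set Y := (T.2)⁻¹ • T.1 with hY
  have hTY : T = T.2 • ((Y, 1) : E × ℝ) := by
    ext <;> simp [hY, ha]
  have hort : ∀ X : E, flatForm ε n (fderiv ℝ φ z (Y, 1)) (fderiv ℝ φ z (X, 0)) = 0 := fun X => by
    have h1 := hT (X, 0)
    rw [hTY, map_smul, map_neg, map_smul, flatForm_comm] at h1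
    simpa [ha] using h1
  refine ⟨Y, fun X => ⟨hort X, ?_⟩⟩
  let L : E →ₗ[ℝ] Flat n := (fderiv ℝ φ z).toLinearMap ∘ₗ LinearMap.inl ℝ E ℝ
  have hLX : ∀ X, L X = fderiv ℝ φ z (X, 0) := fun X => rfl
  have hπL : ∀ X, π (L X) = X := fun X => hπd.self_of_nhds (X, 0)
  obtain ⟨X', hX'⟩ := mem_range_of_orthogonal hφz L (Function.LeftInverse.injective hπL)
    (fun X => htan _) (fderiv_fderiv_mem_tangentSpaceForm hφ hmem (hort X)) (fun ζ hζ hζn => by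
      -- A vector `ζ` normal to the level set becomes normal to the whole immersion once this
      -- vertical component is added. Second derivatives have no vertical component, so the
      -- correction does not affect the pairing.
      have h1 := hA (ζ, -flatForm ε n (fderiv ℝ φ z (Y, 1)) ζ) hζ (fun W => by
        have hW : W = (W.1 - W.2 • Y, 0) + W.2 • ((Y, 1) : E × ℝ) := by ext <;> simp
        have h2 := hζn (W.1 - W.2 • Y)
        rw [hLX] at h2
        conv_lhs => rw [hW]
        rw [map_add, map_smul, map_add, map_smul]
        simp only [_root_.add_apply, _root_.smul_apply, h2, smul_eq_mul, Prod.snd_add,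
          Prod.smul_snd]
        ring) (X, 0) (by
          rw [hTY, map_smul, map_smul]
          simp [hort X])
      rw [hTY, map_smul] at h1
      simpa [ha] using h1)
  -- The second derivative is tangent to the level set, where `π` is injective, and `π` kills it.
  have h0 := hπL X'
  rw [hX', hπdd] at h0
  rw [← hX', ← h0, map_zero]

/-- The function `X ↦ ⟨φ_* X, φ - c⟩` of the point, where `X` is tangent to the level sets of the
height function. -/
noncomputable def tangentialSupport (ε : SignType) (φ : E × ℝ → Flat n) (c : Flat n)
    (z : E × ℝ) : E →L[ℝ] ℝ :=
  (((flatForm ε n).flip (φ z - c)).comp (fderiv ℝ φ z)).comp (ContinuousLinearMap.inl ℝ E ℝ)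

theorem tangentialSupport_apply (φ : E × ℝ → Flat n) (c : Flat n) (z : E × ℝ) (X : E) :
    tangentialSupport ε φ c z X = flatForm ε n (fderiv ℝ φ z (X, 0)) (φ z - c) := rfl

theorem contDiffAt_tangentialSupport {φ : E × ℝ → Flat n} {z : E × ℝ} (c : Flat n)
    (hφ : ContDiffAt ℝ ∞ φ z) : ContDiffAt ℝ ∞ (tangentialSupport ε φ c) z :=
  ((((flatForm ε n).flip.contDiff.contDiffAt.comp z (hφ.sub contDiffAt_const)).clm_comp
    (hφ.fderiv_right (m := ∞) le_rfl)).clm_comp contDiffAt_const)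

/-- This formula is used twice. For `W` characteristic both terms vanish, so the support is constant
along `W`. Where `φ z = c` the first term vanishes and the induced metric of the level set remains,
which is nondegenerate. -/
theorem fderiv_tangentialSupport {φ : E × ℝ → Flat n} {z : E × ℝ} (c : Flat n)
    (hφ : ContDiffAt ℝ ∞ φ z) (W : E × ℝ) (X : E) :
    fderiv ℝ (tangentialSupport ε φ c) z W X =
      flatForm ε n (fderiv ℝ (fderiv ℝ φ) z W (X, 0)) (φ z - c) +
        flatForm ε n (fderiv ℝ φ z (X, 0)) (fderiv ℝ φ z W) := by
  have hd := (contDiffAt_tangentialSupport (ε := ε) c hφ).differentiableAt (by simp)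
  have h1 : fderiv ℝ (fun w => tangentialSupport ε φ c w X) z W =
      fderiv ℝ (tangentialSupport ε φ c) z W X := by
    rw [fderiv_clm_apply hd (differentiableAt_const _)]
    simp
  rw [← h1]
  simp only [tangentialSupport_apply]
  rw [fderiv_flatForm (differentiableAt_fderiv_apply hφ _)
    ((hφ.differentiableAt (by simp)).sub_const c), fderiv_fderiv_apply hφ, fderiv_sub_const]

/-- Coordinates in which the characteristic directions of a map in class `𝒜` are the lines
orthogonal to the level sets of the height function. -/
theorem exists_adapted_coordinates [FiniteDimensional ℝ E] {φ : E × ℝ → Flat n} {Ω : Set (E × ℝ)}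
    {π : Flat n →L[ℝ] E} (hΩ : IsOpen Ω) (hφ : ContDiffOn ℝ ∞ φ Ω)
    (hmem : ∀ w ∈ Ω, φ w ∈ spaceForm ε n) (hπ : ∀ w ∈ Ω, π (φ w) = w.1)
    (hA : ∀ w ∈ Ω, IsClassAImmersionAt ε (fun w => (φ w, w.2)) w) {z₀ : E × ℝ} (hz₀ : z₀ ∈ Ω) :
    ∃ e : OpenPartialHomeomorph (E × ℝ) (E × ℝ), z₀ ∈ e.source ∧ e.source ⊆ Ω ∧
      ContDiffOn ℝ ∞ e e.source ∧ ContDiffOn ℝ ∞ e.symm e.target ∧ (∀ z, (e z).2 = z.2) ∧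
      ∀ w ∈ e.target,
        (∀ X : E, flatForm ε n (fderiv ℝ (φ ∘ e.symm) w (0, 1))
          (fderiv ℝ φ (e.symm w) (X, 0)) = 0) ∧
        (∀ X : E, fderiv ℝ (fderiv ℝ φ) (e.symm w) (fderiv ℝ e.symm w (0, 1)) (X, 0) = 0) ∧
        (∀ Z : E, ∃ X : E, fderiv ℝ (φ ∘ e.symm) w (Z, 0) = fderiv ℝ φ (e.symm w) (X, 0)) ∧
        (∀ X : E, ∃ Z : E, fderiv ℝ (φ ∘ e.symm) w (Z, 0) = fderiv ℝ φ (e.symm w) (X, 0)) ∧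
        ∀ Z : E, fderiv ℝ (φ ∘ e.symm) w (Z, 0) = 0 → Z = 0 := by
  have hcd : ∀ w ∈ Ω, ContDiffAt ℝ ∞ φ w := fun w hw => hφ.contDiffAt (hΩ.mem_nhds hw)
  have hmem' : ∀ w ∈ Ω, ∀ᶠ v in 𝓝 w, φ v ∈ spaceForm ε n := fun w hw =>
    Filter.mem_of_superset (hΩ.mem_nhds hw) hmem
  have hπ' : ∀ w ∈ Ω, ∀ᶠ v in 𝓝 w, π (φ v) = v.1 := fun w hw =>
    Filter.mem_of_superset (hΩ.mem_nhds hw) hπ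
  have hinj : ∀ w ∈ Ω, ∀ X : E, fderiv ℝ φ w (X, 0) = 0 → X = 0 := fun w hw X hX => by
    have h := map_fderiv_eq_fst ((hcd w hw).differentiableAt (by simp)) (hπ' w hw) (X, 0)
    rw [hX, map_zero] at h
    exact h.symm
  -- Any linear identification will do; it only serves to give the new coordinates values in `E ×
  -- ℝ`.
  let R : (E →L[ℝ] ℝ) ≃L[ℝ] E := ContinuousLinearEquiv.ofFinrankEq (by
    rw [← LinearMap.toContinuousLinearMap.finrank_eq]
    exact Subspace.dual_finrank_eq (K := ℝ) (V := E))
  set q := tangentialSupport ε φ (φ z₀) with hq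
  let κ : E × ℝ → E × ℝ := fun z => (R (q z), z.2)
  have hκ : ContDiffOn ℝ ∞ κ Ω := fun w hw =>
    ((R.contDiff.contDiffAt.comp w (contDiffAt_tangentialSupport _ (hcd w hw))).prodMk
      contDiffAt_snd).contDiffWithinAt
  have hκd : ∀ w ∈ Ω, ∀ X, fderiv ℝ κ w X = (R (fderiv ℝ q w X), X.2) := fun w hw X => by
    have hqd := ((contDiffAt_tangentialSupport (ε := ε) (φ z₀) (hcd w hw)).differentiableAt
      (by simp)).hasFDerivAt
    have : HasFDerivAt κ _ w := ((R.hasFDerivAt (x := q w)).comp w hqd).prodMk (hasFDerivAt_snd (𝕜 := ℝ) (p := w))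
    rw [this.fderiv]
    rfl
  have hκinj : Function.Injective (fderiv ℝ κ z₀) := by
    rw [← ContinuousLinearMap.coe_coe, ← LinearMap.ker_eq_bot, LinearMap.ker_eq_bot']
    rintro ⟨X, t⟩ hX
    rw [ContinuousLinearMap.coe_coe, hκd z₀ hz₀] at hX
    obtain rfl : t = 0 := congrArg Prod.snd hX
    have h1 : fderiv ℝ q z₀ (X, 0) = 0 := R.injective
      ((congrArg Prod.fst hX).trans (map_zero R).symm)
    have h2 := DFunLike.congr_fun h1 X
    rw [hq, fderiv_tangentialSupport _ (hcd z₀ hz₀)] at h2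
    simp only [sub_self, map_zero, zero_add] at h2
    have h3 := eq_zero_of_flatForm_self (hmem z₀ hz₀) (fderiv_mem_tangentSpaceForm
      ((hcd z₀ hz₀).differentiableAt (by simp)) (hmem' z₀ hz₀) _) h2
    rw [hinj z₀ hz₀ X h3]
    rfl
  obtain ⟨e, he₀, heΩ, heκ, -, hes⟩ :=
    exists_openPartialHomeomorph_of_injective rfl hΩ hκ hz₀ hκinj
  refine ⟨e, he₀, heΩ, heκ ▸ hκ.mono heΩ, hes, fun z => by rw [heκ], fun w hw => ?_⟩
  have hz := heΩ (e.map_target hw)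
  have hzs := e.map_target hw
  set z := e.symm w
  have hκz : DifferentiableAt ℝ κ z :=
    (hκ.contDiffAt (hΩ.mem_nhds hz)).differentiableAt (by simp)
  have hsw : DifferentiableAt ℝ e.symm w :=
    (hes.contDiffAt (e.open_target.mem_nhds hw)).differentiableAt (by simp)
  have hκs : ∀ X, fderiv ℝ κ z (fderiv ℝ e.symm w X) = X := fun X => by
    have h1 : κ ∘ e.symm =ᶠ[𝓝 w] id := by
      filter_upwards [e.open_target.mem_nhds hw] with v hv
      rw [← heκ]
      exact e.right_inv hv
    have h2 := h1.fderiv_eq (𝕜 := ℝ)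
    rw [fderiv_comp (f := e.symm) w hκz hsw, fderiv_id] at h2
    exact DFunLike.congr_fun h2 X
  have hsκ : ∀ X, fderiv ℝ e.symm w (fderiv ℝ κ z X) = X := fun X => by
    have hw' : e z = w := e.right_inv hw
    have h1 : e.symm ∘ κ =ᶠ[𝓝 z] id := by
      filter_upwards [e.open_source.mem_nhds hzs] with v hv
      rw [← heκ]
      exact e.left_inv hv
    have h2 := h1.fderiv_eq (𝕜 := ℝ)
    rw [fderiv_comp z (by rwa [← heκ, hw']) hκz, fderiv_id, ← heκ, hw', heκ] at h2
    exact DFunLike.congr_fun h2 X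
  have hφs : ∀ X, fderiv ℝ (φ ∘ e.symm) w X = fderiv ℝ φ z (fderiv ℝ e.symm w X) := fun X => by
    rw [fderiv_comp (f := e.symm) w ((hcd z hz).differentiableAt (by simp)) hsw]
    rfl
  have hlevel : ∀ Z : E, fderiv ℝ e.symm w (Z, 0) = ((fderiv ℝ e.symm w (Z, 0)).1, 0) :=
    fun Z => by
      have h1 := congrArg Prod.snd (hκs (Z, 0))
      rw [hκd z hz] at h1
      exact Prod.ext rfl h1
  obtain ⟨Y, hY⟩ := exists_characteristic_direction (hcd z hz) (hmem' z hz) (hπ' z hz) (hA z hz)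
  -- The differential of `κ` sends `(Y, 1)` to `(0, 1)`, because `q` is constant to first order in
  -- the characteristic direction.
  have hYs : fderiv ℝ e.symm w (0, 1) = (Y, 1) := by
    have h1 : fderiv ℝ q z (Y, 1) = 0 := by
      ext X
      rw [hq, fderiv_tangentialSupport _ (hcd z hz), (hY X).2, flatForm_comm _
        (fderiv ℝ φ z (Y, 1)), (hY X).1]
      simp
    rw [← hsκ (Y, 1), hκd z hz, h1, map_zero]
  refine ⟨fun X => ?_, fun X => ?_, fun Z => ?_, fun X => ?_, fun Z hZ => ?_⟩
  · rw [hφs, hYs, (hY X).1]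
  · rw [hYs, (hY X).2]
  · exact ⟨(fderiv ℝ e.symm w (Z, 0)).1, by rw [hφs, ← hlevel]⟩
  · refine ⟨(fderiv ℝ κ z (X, 0)).1, ?_⟩
    have h1 : ((fderiv ℝ κ z (X, 0)).1, (0 : ℝ)) = fderiv ℝ κ z (X, 0) := by
      rw [hκd z hz]
    rw [hφs, h1, hsκ]
  · rw [hφs, hlevel] at hZ
    have h1 := hκs (Z, 0)
    rw [hlevel, hinj z hz _ hZ] at h1
    have h2 : ((0 : E), (0 : ℝ)) = 0 := rfl
    rw [h2, map_zero] at h1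
    exact (congrArg Prod.fst h1).symm

end Local

/-! ### Orthonormal frames as isometric embeddings of the smaller space form. -/

section Frame

variable {ε : SignType} {n k : ℕ}

theorem metricSign_of_ne_zero (hε : ε ≠ 0) : metricSign ε = (ε : ℝ) := by
  match ε, hε with
  | .pos, _ => simp [metricSign]
  | .neg, _ => simp [metricSign]

/-- An orthonormal frame `g, ξ_1, …, ξ_k` defines an isometric embedding `𝔼^{k+1} → 𝔼^{n+1}`. -/
theorem flatForm_frame (hε : ε ≠ 0) {g : Flat n} {ξ : Fin k → Flat n} (hg : g ∈ spaceForm ε n)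
    (hξ : ∀ i, ξ i ∈ tangentSpaceForm ε g)
    (hort : ∀ i j, flatForm ε n (ξ i) (ξ j) = if i = j then 1 else 0) (v w : Flat k) :
    flatForm ε n (v 0 • g + ∑ i, v i.succ • ξ i) (w 0 • g + ∑ i, w i.succ • ξ i) =
      flatForm ε k v w := by
  have hgg := flatForm_self_of_mem_spaceForm hε hg
  have hgξ : ∀ i, flatForm ε n g (ξ i) = 0 := fun i =>
    (mem_tangentSpaceForm_of_ne_zero hε).1 (hξ i)
  have hξg : ∀ i, flatForm ε n (ξ i) g = 0 := fun i => (flatForm_comm _ _).trans (hgξ i)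
  simp only [map_add, map_sum, map_smul, _root_.add_apply, _root_.sum_apply, _root_.smul_apply,
    smul_eq_mul, hgg, hgξ, hξg, hort, mul_zero, Finset.sum_const_zero, add_zero, zero_add,
    mul_ite, mul_one, Finset.sum_ite_eq', Finset.mem_univ, if_true]
  simp only [flatForm_apply, flatInner, metricSign_of_ne_zero hε]
  congr 1
  · ring
  · exact Finset.sum_congr rfl fun i _ => mul_comm _ _

theorem frame_mem_spaceForm_iff {g : Flat n} {ξ : Fin k → Flat n} (hg : g ∈ spaceForm ε n)
    (hξ : ∀ i, ξ i ∈ tangentSpaceForm ε g)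
    (hort : ∀ i j, flatForm ε n (ξ i) (ξ j) = if i = j then 1 else 0) (v : Flat k) :
    v 0 • g + ∑ i, v i.succ • ξ i ∈ spaceForm ε n ↔ v ∈ spaceForm ε k := by
  match ε with
  | .zero =>
    have h0 : ∀ i, ξ i 0 = 0 := hξ
    have h1 : g 0 = 1 := hg
    change (v 0 • g + ∑ i, v i.succ • ξ i) 0 = 1 ↔ v 0 = 1
    simp [h0, h1]
  | .pos =>
    change flatForm .pos n _ _ = 1 ↔ flatForm .pos k _ _ = 1
    rw [flatForm_frame (by decide) hg hξ hort]
  | .neg =>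
    change flatForm .neg n _ _ = -1 ∧ _ ↔ flatForm .neg k _ _ = -1 ∧ _
    rw [flatForm_frame (by decide) hg hξ hort]
    refine and_congr_right fun h => ?_
    -- The choice of sheet is detected by the product with `g`, which equals `-v 0`.
    rw [← flatForm_neg_iff hg ((flatForm_frame (by decide) hg hξ hort v v).trans h)]
    have hgξ : ∀ i, flatForm (-1) n g (ξ i) = 0 := fun i =>
      (mem_tangentSpaceForm_of_ne_zero (by decide)).1 (hξ i)
    have hgg : flatForm (-1) n g g = -1 := hg.1
    simp [hgξ, hgg]

end Frame

/-! ### Adapted maps and their description as tubes. -/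

section Adapted

variable {ε : SignType} {n : ℕ} {E : Type*} [NormedAddCommGroup E] [NormedSpace ℝ E]

/-- The level sets of `Φ : B × J → ℚ_ε^n` have parallel tangent spaces along `{y} × J`, and
`{y} × J` is orthogonal to them. -/
structure IsAdapted (ε : SignType) (Φ : E × ℝ → Flat n) (B : Set E) (J : Set ℝ) : Prop where
  isOpen_B : IsOpen B
  isPreconnected_B : IsPreconnected B
  isOpen_J : IsOpen J
  isPreconnected_J : IsPreconnected J
  smooth : ContDiffOn ℝ ∞ Φ (B ×ˢ J)
  mem : ∀ y ∈ B, ∀ s ∈ J, Φ (y, s) ∈ spaceForm ε n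
  injective : ∀ y ∈ B, ∀ s ∈ J, ∀ Z, fderiv ℝ Φ (y, s) (Z, 0) = 0 → Z = 0
  parallel : ∀ y ∈ B, ∀ s ∈ J, ∀ t ∈ J, ∀ Z,
    ∃ Z', fderiv ℝ Φ (y, s) (Z, 0) = fderiv ℝ Φ (y, t) (Z', 0)
  orthogonal : ∀ y ∈ B, ∀ s ∈ J, ∀ t ∈ J, ∀ Z,
    flatForm ε n (fderiv ℝ Φ (y, s) (0, 1)) (fderiv ℝ Φ (y, t) (Z, 0)) = 0

theorem hasFDerivAt_slice_left {F : Type*} [NormedAddCommGroup F] [NormedSpace ℝ F]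
    {Φ : E × ℝ → F} {y : E} {s : ℝ} (h : DifferentiableAt ℝ Φ (y, s)) :
    HasFDerivAt (fun x => Φ (x, s)) ((fderiv ℝ Φ (y, s)).comp (ContinuousLinearMap.inl ℝ E ℝ)) y :=
  h.hasFDerivAt.comp y (hasFDerivAt_prodMk_left y s)

theorem hasDerivAt_slice_right {F : Type*} [NormedAddCommGroup F] [NormedSpace ℝ F]
    {Φ : E × ℝ → F} {y : E} {s : ℝ} (h : DifferentiableAt ℝ Φ (y, s)) :
    HasDerivAt (fun t => Φ (y, t)) (fderiv ℝ Φ (y, s) (0, 1)) s :=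
  h.hasFDerivAt.comp_hasDerivAt s ((hasDerivAt_const s y).prodMk (hasDerivAt_id s))

/-- The vanishing of the mixed second derivative integrates over the interval `J`: `φ_*(X, 0)` is
the same vector at all points of `{y} × J`. This turns the pointwise conditions into conditions
comparing two parameters `s` and `t`. -/
theorem isAdapted_of_coordinates {φ : E × ℝ → Flat n} {Ω : Set (E × ℝ)} (hΩ : IsOpen Ω)
    (hφ : ContDiffOn ℝ ∞ φ Ω) (hmem : ∀ w ∈ Ω, φ w ∈ spaceForm ε n)
    (e : OpenPartialHomeomorph (E × ℝ) (E × ℝ)) (heΩ : e.source ⊆ Ω)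
    (hes : ContDiffOn ℝ ∞ e.symm e.target)
    (he : ∀ w ∈ e.target,
        (∀ X : E, flatForm ε n (fderiv ℝ (φ ∘ e.symm) w (0, 1))
          (fderiv ℝ φ (e.symm w) (X, 0)) = 0) ∧
        (∀ X : E, fderiv ℝ (fderiv ℝ φ) (e.symm w) (fderiv ℝ e.symm w (0, 1)) (X, 0) = 0) ∧
        (∀ Z : E, ∃ X : E, fderiv ℝ (φ ∘ e.symm) w (Z, 0) = fderiv ℝ φ (e.symm w) (X, 0)) ∧
        (∀ X : E, ∃ Z : E, fderiv ℝ (φ ∘ e.symm) w (Z, 0) = fderiv ℝ φ (e.symm w) (X, 0)) ∧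
        ∀ Z : E, fderiv ℝ (φ ∘ e.symm) w (Z, 0) = 0 → Z = 0)
    {B : Set E} {J : Set ℝ} (hB : IsOpen B) (hBc : IsPreconnected B) (hJ : IsOpen J)
    (hJc : IsPreconnected J) (hBJ : B ×ˢ J ⊆ e.target) : IsAdapted ε (φ ∘ e.symm) B J := by
  have hmaps : ∀ y ∈ B, ∀ s ∈ J, (y, s) ∈ e.target := fun y hy s hs => hBJ ⟨hy, hs⟩
  have hconst : ∀ y ∈ B, ∀ s ∈ J, ∀ t ∈ J, ∀ X : E,
      fderiv ℝ φ (e.symm (y, s)) (X, 0) = fderiv ℝ φ (e.symm (y, t)) (X, 0) := by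
    intro y hy s hs t ht X
    have hder : ∀ r ∈ J, HasDerivAt (fun r => fderiv ℝ φ (e.symm (y, r)) (X, 0)) 0 r := by
      intro r hr
      have hw := hmaps y hy r hr
      have hcd : ContDiffAt ℝ ∞ φ (e.symm (y, r)) :=
        hφ.contDiffAt (hΩ.mem_nhds (heΩ (e.map_target hw)))
      have h1 := (hes.contDiffAt (e.open_target.mem_nhds hw)).differentiableAt (by simp)
      have h2 := (differentiableAt_fderiv_apply hcd (X, 0)).hasFDerivAt.comp_hasDerivAt r
        (hasDerivAt_slice_right h1)
      rwa [fderiv_fderiv_apply hcd, (he _ hw).2.1] at h2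
    exact hJ.is_const_of_deriv_eq_zero hJc
      (fun r hr => (hder r hr).differentiableAt.differentiableWithinAt)
      (fun r hr => (hder r hr).deriv) hs ht
  refine ⟨hB, hBc, hJ, hJc, ?_, fun y hy s hs => ?_, fun y hy s hs Z => ?_,
    fun y hy s hs t ht Z => ?_, fun y hy s hs t ht Z => ?_⟩
  · exact hφ.comp (hes.mono hBJ) fun w hw => heΩ (e.map_target (hBJ hw))
  · exact hmem _ (heΩ (e.map_target (hmaps y hy s hs)))
  · exact (he _ (hmaps y hy s hs)).2.2.2.2 Z
  · obtain ⟨X, hX⟩ := (he _ (hmaps y hy s hs)).2.2.1 Z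
    obtain ⟨Z', hZ'⟩ := (he _ (hmaps y hy t ht)).2.2.2.1 X
    exact ⟨Z', by rw [hX, hZ', hconst y hy s hs t ht]⟩
  · obtain ⟨X, hX⟩ := (he _ (hmaps y hy t ht)).2.2.1 Z
    rw [hX, hconst y hy t ht s hs]
    exact (he _ (hmaps y hy s hs)).1 X

namespace IsAdapted

variable {Φ : E × ℝ → Flat n} {B : Set E} {J : Set ℝ}

theorem contDiffAt (h : IsAdapted ε Φ B J) {y : E} (hy : y ∈ B) {s : ℝ} (hs : s ∈ J) :
    ContDiffAt ℝ ∞ Φ (y, s) :=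
  h.smooth.contDiffAt ((h.isOpen_B.prod h.isOpen_J).mem_nhds ⟨hy, hs⟩)

theorem differentiableAt (h : IsAdapted ε Φ B J) {y : E} (hy : y ∈ B) {s : ℝ} (hs : s ∈ J) :
    DifferentiableAt ℝ Φ (y, s) := (h.contDiffAt hy hs).differentiableAt (by simp)

theorem fderiv_left (h : IsAdapted ε Φ B J) {y : E} (hy : y ∈ B) {s : ℝ} (hs : s ∈ J) (Z : E) :
    fderiv ℝ (fun x => Φ (x, s)) y Z = fderiv ℝ Φ (y, s) (Z, 0) := by
  rw [(hasFDerivAt_slice_left (h.differentiableAt hy hs)).fderiv]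
  rfl

theorem contDiffAt_left (h : IsAdapted ε Φ B J) {y : E} (hy : y ∈ B) {s : ℝ} (hs : s ∈ J) :
    ContDiffAt ℝ ∞ (fun x => Φ (x, s)) y :=
  (h.contDiffAt hy hs).comp y (contDiffAt_id.prodMk contDiffAt_const)

theorem contDiffAt_right (h : IsAdapted ε Φ B J) {y : E} (hy : y ∈ B) {s : ℝ} (hs : s ∈ J) :
    ContDiffAt ℝ ∞ (fun t => Φ (y, t)) s :=
  (h.contDiffAt hy hs).comp s (contDiffAt_const.prodMk contDiffAt_id)

theorem differentiableAt_left (h : IsAdapted ε Φ B J) {y : E} (hy : y ∈ B) {s : ℝ} (hs : s ∈ J) :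
    DifferentiableAt ℝ (fun x => Φ (x, s)) y := (h.contDiffAt_left hy hs).differentiableAt (by simp)

theorem fderiv_mem (h : IsAdapted ε Φ B J) {y : E} (hy : y ∈ B) {s : ℝ} (hs : s ∈ J) (Z : E) :
    fderiv ℝ Φ (y, s) (Z, 0) ∈ tangentSpaceForm ε (Φ (y, s)) := by
  rw [← h.fderiv_left hy hs]
  exact fderiv_mem_tangentSpaceForm (u := fun x => Φ (x, s)) (h.differentiableAt_left hy hs)
    (Filter.mem_of_superset (h.isOpen_B.mem_nhds hy) fun x hx => h.mem x hx s hs) Z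

/-- The derivative in the second slot pairs `Φ_*(0, 1)` at one parameter with `Φ_*(Z, 0)` at
another, which is zero by `orthogonal`. -/
theorem flatForm_fderiv_const (h : IsAdapted ε Φ B J) {y : E} (hy : y ∈ B) {s t r : ℝ}
    (hs : s ∈ J) (ht : t ∈ J) (hr : r ∈ J) (Z : E) :
    flatForm ε n (fderiv ℝ Φ (y, r) (Z, 0)) (Φ (y, s)) =
      flatForm ε n (fderiv ℝ Φ (y, r) (Z, 0)) (Φ (y, t)) := by
  have hder : ∀ u ∈ J, HasDerivAt
      (fun u => flatForm ε n (fderiv ℝ Φ (y, r) (Z, 0)) (Φ (y, u))) 0 u := fun u hu => by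
    have h1 := (flatForm ε n (fderiv ℝ Φ (y, r) (Z, 0))).hasFDerivAt.comp_hasDerivAt u
      (hasDerivAt_slice_right (h.differentiableAt hy hu))
    rwa [flatForm_comm, h.orthogonal y hy u hu r hr] at h1
  exact h.isOpen_J.is_const_of_deriv_eq_zero h.isPreconnected_J
    (fun u hu => (hder u hu).differentiableAt.differentiableWithinAt)
    (fun u hu => (hder u hu).deriv) hs ht

theorem flatForm_fderiv_of_ne_zero (h : IsAdapted ε Φ B J) (hε : ε ≠ 0) {y : E} (hy : y ∈ B)
    {s r : ℝ} (hs : s ∈ J) (hr : r ∈ J) (Z : E) :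
    flatForm ε n (fderiv ℝ Φ (y, r) (Z, 0)) (Φ (y, s)) = 0 := by
  rw [h.flatForm_fderiv_const hy hs hr hr, flatForm_comm]
  exact (mem_tangentSpaceForm_of_ne_zero hε).1 (h.fderiv_mem hy hr Z)

theorem flatForm_const (h : IsAdapted ε Φ B J) {u v : E → Flat n}
    (hu : ∀ y ∈ B, DifferentiableAt ℝ u y) (hv : ∀ y ∈ B, DifferentiableAt ℝ v y)
    (huv : ∀ y ∈ B, ∀ Z, flatForm ε n (fderiv ℝ u y Z) (v y) = 0)
    (hvu : ∀ y ∈ B, ∀ Z, flatForm ε n (fderiv ℝ v y Z) (u y) = 0) {y z : E} (hy : y ∈ B)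
    (hz : z ∈ B) : flatForm ε n (u y) (v y) = flatForm ε n (u z) (v z) := by
  refine h.isOpen_B.is_const_of_fderiv_eq_zero (𝕜 := ℝ) (f := fun y => flatForm ε n (u y) (v y))
    h.isPreconnected_B (fun x hx => ?_) (fun x hx => ?_) hy hz
  · exact ((flatForm ε n).hasFDerivAt_of_bilinear (hu x hx).hasFDerivAt
      (hv x hx).hasFDerivAt).differentiableAt.differentiableWithinAt
  · ext Z
    rw [fderiv_flatForm (hu x hx) (hv x hx), huv x hx, flatForm_comm, hvu x hx]
    simp

/-- The component of `Φ(·, s)` along `Φ(·, s₀)` has a constant coefficient. -/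
theorem exists_coefficient (h : IsAdapted ε Φ B J) {s₀ : ℝ} (hs₀ : s₀ ∈ J) {y₀ : E}
    (hy₀ : y₀ ∈ B) : ∃ a : ℝ → ℝ, ContDiffOn ℝ ∞ a J ∧ ∀ y ∈ B, ∀ s ∈ J,
      Φ (y, s) - a s • Φ (y, s₀) ∈ tangentSpaceForm ε (Φ (y, s₀)) ∧
      ∀ t ∈ J, ∀ Z, flatForm ε n (fderiv ℝ Φ (y, t) (Z, 0)) (Φ (y, s) - a s • Φ (y, s₀)) = 0 := by
  rcases eq_or_ne ε 0 with rfl | hε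
  -- In the affine hyperplane, plain differences of points are tangent.
  · refine ⟨fun _ => 1, contDiffOn_const, fun y hy s hs => ⟨?_, fun t ht Z => ?_⟩⟩
    · have h1 : Φ (y, s) 0 = 1 := h.mem y hy s hs
      have h2 : Φ (y, s₀) 0 = 1 := h.mem y hy s₀ hs₀
      rw [mem_tangentSpaceForm_zero]
      simp [h1, h2]
    · rw [one_smul, map_sub, h.flatForm_fderiv_const hy hs hs₀ ht, sub_self]
  -- Since `⟨Φ, Φ⟩ = ε` and `ε² = 1`, this is the coefficient of the orthogonal projection to the
  -- line of `Φ(y₀, s₀)`. It serves for all `y` because the product does not depend on `y`.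
  · refine ⟨fun s => (ε : ℝ) * flatForm ε n (Φ (y₀, s₀)) (Φ (y₀, s)), fun s hs => ?_,
      fun y hy s hs => ⟨?_, fun t ht Z => ?_⟩⟩
    · exact (contDiffAt_const.mul ((flatForm ε n (Φ (y₀, s₀))).contDiff.contDiffAt.comp s
        (h.contDiffAt_right hy₀ hs))).contDiffWithinAt
    · have hc : flatForm ε n (Φ (y, s₀)) (Φ (y, s)) = flatForm ε n (Φ (y₀, s₀)) (Φ (y₀, s)) :=
        h.flatForm_const (u := fun y => Φ (y, s₀)) (v := fun y => Φ (y, s))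
          (fun y hy => h.differentiableAt_left hy hs₀) (fun y hy => h.differentiableAt_left hy hs)
          (fun y hy Z => by
            rw [h.fderiv_left hy hs₀, h.flatForm_fderiv_of_ne_zero hε hy hs hs₀])
          (fun y hy Z => by
            rw [h.fderiv_left hy hs, h.flatForm_fderiv_of_ne_zero hε hy hs₀ hs]) hy hy₀
      have hεε : (ε : ℝ) * ε = 1 := by
        match ε, hε with
        | .pos, _ => simp
        | .neg, _ => simp
      rw [mem_tangentSpaceForm_of_ne_zero hε, map_sub, map_smul, hc,
        flatForm_self_of_mem_spaceForm hε (h.mem y hy s₀ hs₀), smul_eq_mul]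
      linear_combination -(flatForm ε n (Φ (y₀, s₀)) (Φ (y₀, s))) * hεε
    · rw [map_sub, map_smul, h.flatForm_fderiv_of_ne_zero hε hy hs ht,
        h.flatForm_fderiv_of_ne_zero hε hy hs₀ ht, smul_zero, sub_zero]

/-- An adapted map is a partial tube. -/
theorem exists_tube (h : IsAdapted ε Φ B J) {s₀ : ℝ} (hs₀ : s₀ ∈ J) {y₀ : E} (hy₀ : y₀ ∈ B) :
    ∃ (k : ℕ) (ξ : Fin k → E → Flat n) (v : ℝ → Flat k),
      ContDiffOn ℝ ∞ v J ∧ (∀ s ∈ J, v s ∈ spaceForm ε k) ∧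
      (∀ y ∈ B, ∀ i, ContDiffAt ℝ ∞ (ξ i) y) ∧
      (∀ y ∈ B, ∀ i, ξ i y ∈ tangentSpaceForm ε (Φ (y, s₀))) ∧
      (∀ y ∈ B, ∀ i Z, flatForm ε n (fderiv ℝ (fun x => Φ (x, s₀)) y Z) (ξ i y) = 0) ∧
      (∀ y ∈ B, ∀ i j, flatForm ε n (ξ i y) (ξ j y) = if i = j then 1 else 0) ∧
      (∀ y ∈ B, ∀ i Z, ∃ Z', fderiv ℝ (ξ i) y Z = fderiv ℝ (fun x => Φ (x, s₀)) y Z') ∧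
      ∀ y ∈ B, ∀ s ∈ J, Φ (y, s) = v s 0 • Φ (y, s₀) + ∑ i, v s i.succ • ξ i y := by
  obtain ⟨a, ha, hσ⟩ := h.exists_coefficient hs₀ hy₀
  let σ : J → E → Flat n := fun s y => Φ (y, s) - a s • Φ (y, s₀)
  have hσs : ∀ s : J, ∀ y ∈ B, ContDiffAt ℝ ∞ (σ s) y := fun s y hy =>
    (h.contDiffAt_left hy s.2).sub ((h.contDiffAt_left hy hs₀).const_smul (a s))
  have hσd : ∀ s : J, ∀ y ∈ B, ∀ Z, fderiv ℝ (σ s) y Z =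
      fderiv ℝ Φ (y, s) (Z, 0) - a s • fderiv ℝ Φ (y, s₀) (Z, 0) := fun s y hy Z => by
    have h1 : HasFDerivAt (σ s) _ y :=
      (hasFDerivAt_slice_left (h.differentiableAt hy s.2)).sub
        ((hasFDerivAt_slice_left (h.differentiableAt hy hs₀)).const_smul (a s))
    rw [h1.fderiv]
    rfl
  have hσσ : ∀ s t : J, ∀ y ∈ B, ∀ Z, flatForm ε n (fderiv ℝ (σ s) y Z) (σ t y) = 0 :=
    fun s t y hy Z => by
      have h1 : flatForm ε n (fderiv ℝ Φ (y, s) (Z, 0)) (σ t y) = 0 := (hσ y hy t t.2).2 s s.2 Z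
      have h2 : flatForm ε n (fderiv ℝ Φ (y, s₀) (Z, 0)) (σ t y) = 0 := (hσ y hy t t.2).2 s₀ hs₀ Z
      rw [hσd s y hy, (flatForm ε n).map_sub, (flatForm ε n).map_smul, _root_.sub_apply,
        _root_.smul_apply, h1, h2, smul_zero, sub_zero]
  -- The slices have the same tangent spaces, so the derivatives of `σ s` are tangent to `g = Φ(·,
  -- s₀)`: the sections are parallel in the normal bundle.
  have hσr : ∀ s : J, ∀ y ∈ B, ∀ Z, fderiv ℝ (σ s) y Z ∈
      LinearMap.range (fderiv ℝ (fun x => Φ (x, s₀)) y).toLinearMap := fun s y hy Z => by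
    obtain ⟨Z', hZ'⟩ := h.parallel y hy s s.2 s₀ hs₀ Z
    rw [hσd s y hy, hZ', ← h.fderiv_left hy hs₀, ← h.fderiv_left hy hs₀]
    exact Submodule.sub_mem _ ⟨_, rfl⟩ (Submodule.smul_mem _ _ ⟨_, rfl⟩)
  obtain ⟨k, c, hort, hspan⟩ := exists_orthonormal_combinations (ε := ε)
    (fun (s : J) (y : B) => σ s y) (fun y : B => Φ (y, s₀)) (fun y => h.mem y y.2 s₀ hs₀)
    (fun s y => (hσ y y.2 s s.2).1) ⟨y₀, hy₀⟩ (fun s t y =>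
      h.flatForm_const (u := σ s) (v := σ t) (fun y hy => (hσs s y hy).differentiableAt (by simp))
        (fun y hy => (hσs t y hy).differentiableAt (by simp)) (hσσ s t) (hσσ t s) y.2 hy₀)
  let ξ : Fin k → E → Flat n := fun i y => Finsupp.linearCombination ℝ (fun s => σ s y) (c i)
  have hξ : ∀ i, ξ i = fun y => ∑ s ∈ (c i).support, c i s • σ s y := fun i => by
    funext y
    simp only [ξ, Finsupp.linearCombination_apply, Finsupp.sum]
  have hξt : ∀ y ∈ B, ∀ i, ξ i y ∈ tangentSpaceForm ε (Φ (y, s₀)) := fun y hy i => by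
    rw [hξ]
    exact Submodule.sum_mem (tangentSubmodule ε _) fun s _ =>
      Submodule.smul_mem _ _ (hσ y hy s s.2).1
  let w : ℝ → Flat n := fun s => Φ (y₀, s) - a s • Φ (y₀, s₀)
  -- The coefficients can be computed at `y₀`, since they are the same at every `y`.
  let v : ℝ → Flat k := fun s => Fin.cons (a s) fun i => flatForm ε n (w s) (ξ i y₀)
  have hv0 : ∀ s, v s 0 = a s := fun s => rfl
  have heq : ∀ y ∈ B, ∀ s ∈ J, Φ (y, s) = v s 0 • Φ (y, s₀) + ∑ i, v s i.succ • ξ i y :=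
    fun y hy s hs => by
      rw [← sub_eq_iff_eq_add', hv0]
      exact hspan ⟨s, hs⟩ ⟨y, hy⟩
  refine ⟨k, ξ, v, ?_, fun s hs => ?_, fun y hy i => ?_, hξt, fun y hy i Z => ?_,
    fun y hy i j => hort i j ⟨y, hy⟩, fun y hy i Z => ?_, heq⟩
  · refine contDiffOn_pi.2 fun j => Fin.cases ha (fun i => ?_) j
    intro s hs
    have hw : ContDiffWithinAt ℝ ∞ w J s :=
      (h.contDiffAt_right hy₀ hs).contDiffWithinAt.sub ((ha s hs).smul contDiffWithinAt_const)
    exact ((flatForm ε n).flip (ξ i y₀)).contDiff.contDiffAt.comp_contDiffWithinAt s hw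
  · have := h.mem y₀ hy₀ s hs
    rw [heq y₀ hy₀ s hs] at this
    exact (frame_mem_spaceForm_iff (h.mem y₀ hy₀ s₀ hs₀) (hξt y₀ hy₀)
      (fun i j => hort i j ⟨y₀, hy₀⟩) _).1 this
  · rw [hξ]
    exact ContDiffAt.sum fun s _ => (hσs s y hy).const_smul (c i s)
  · rw [hξ, map_sum]
    refine Finset.sum_eq_zero fun s _ => ?_
    rw [map_smul, h.fderiv_left hy hs₀, (hσ y hy s s.2).2 s₀ hs₀, smul_zero]
  · have hd : HasFDerivAt (ξ i) (∑ s ∈ (c i).support, c i s • fderiv ℝ (σ s) y) y := by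
      rw [hξ]
      exact HasFDerivAt.fun_sum fun s _ =>
        ((hσs s y hy).differentiableAt (by simp)).hasFDerivAt.const_smul (c i s)
    have hmem : fderiv ℝ (ξ i) y Z ∈
        LinearMap.range (fderiv ℝ (fun x => Φ (x, s₀)) y).toLinearMap := by
      rw [hd.fderiv, _root_.sum_apply]
      exact Submodule.sum_mem _ fun s _ => Submodule.smul_mem _ _ (hσr s y hy Z)
    obtain ⟨Z', hZ'⟩ := hmem
    exact ⟨Z', hZ'.symm⟩

end IsAdapted

end Adapted

/-! ### Height coordinates and product parametrizations. -/

section Coordinates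

variable {ε : SignType} {n : ℕ}

/-- Coordinates in which the height function is the last coordinate and the level sets of the
height function are graphs over their tangent space at one point. -/
theorem exists_height_coordinates {V E : Type*} [NormedAddCommGroup V] [NormedSpace ℝ V]
    [FiniteDimensional ℝ V] [NormedAddCommGroup E] [NormedSpace ℝ E] [FiniteDimensional ℝ E]
    (hdim : Module.finrank ℝ V = Module.finrank ℝ E + 1) {F : V → Flat n × ℝ} {Ω : Set V}
    (hΩ : IsOpen Ω) (hF : ContDiffOn ℝ ∞ F Ω) (hmem : ∀ z ∈ Ω, F z ∈ productSpace ε n) {p : V}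
    (hp : p ∈ Ω) (hA : IsClassAImmersionAt ε F p) :
    ∃ (π : Flat n →L[ℝ] E) (e : OpenPartialHomeomorph V (E × ℝ)), p ∈ e.source ∧ e.source ⊆ Ω ∧
      (∀ z, e z = (π (F z).1, (F z).2)) ∧ ContDiffOn ℝ ∞ e e.source ∧
      ContDiffOn ℝ ∞ e.symm e.target := by
  obtain ⟨hinj, T, hT0, hT, -⟩ := hA
  have hFp : DifferentiableAt ℝ F p := (hF.contDiffAt (hΩ.mem_nhds hp)).differentiableAt (by simp)
  set D := fderiv ℝ F p
  have htan : (D T).1 ∈ tangentSpaceForm ε (F p).1 := by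
    have h1 := fderiv_mem_tangentSpaceForm (u := fun z => (F z).1) hFp.fst
      (Filter.mem_of_superset (hΩ.mem_nhds hp) hmem) T
    rwa [fderiv.fst hFp] at h1
  let l : V →ₗ[ℝ] ℝ := LinearMap.snd ℝ (Flat n) ℝ ∘ₗ D.toLinearMap
  have hlT : l T ≠ 0 := by
    intro h0
    have h0' : (D T).2 = 0 := h0
    have h1 := hT T
    simp only [flatInnerProd_eq, verticalField, Prod.fst_sub, Prod.snd_sub, h0', zero_sub,
      zero_mul, add_zero, map_neg, neg_eq_zero] at h1
    have h2 := eq_zero_of_flatForm_self (hmem p hp) htan h1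
    exact hT0 (hinj ((Prod.ext h2 h0').trans (map_zero D).symm))
  have hl : Function.Surjective l := LinearMap.surjective (fun h => hlT (by rw [h]; rfl))
  have hker : Module.finrank ℝ (LinearMap.ker l) = Module.finrank ℝ E := by
    have h1 := LinearMap.finrank_range_add_finrank_ker l
    rw [LinearMap.range_eq_top.2 hl, finrank_top, Module.finrank_self] at h1
    omega
  let j : LinearMap.ker l ≃ₗ[ℝ] E := LinearEquiv.ofFinrankEq _ _ hker
  let L : LinearMap.ker l →ₗ[ℝ] Flat n :=
    LinearMap.fst ℝ (Flat n) ℝ ∘ₗ D.toLinearMap ∘ₗ (LinearMap.ker l).subtype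
  have hL : LinearMap.ker L = ⊥ := by
    rw [LinearMap.ker_eq_bot']
    intro X hX
    have h1 : (D X).2 = 0 := X.2
    exact Subtype.ext (hinj ((Prod.ext hX h1).trans (map_zero D).symm))
  -- `π` inverts the differential on the tangent space of the level set through `p`, so `(π ∘ F.1,
  -- F.2)` has injective differential there.
  obtain ⟨π₀, hπ₀⟩ := L.exists_leftInverse_of_injective hL
  let π : Flat n →L[ℝ] E := LinearMap.toContinuousLinearMap (j.toLinearMap ∘ₗ π₀)
  let u : V → E × ℝ := fun z => (π (F z).1, (F z).2)
  have hu : ContDiffOn ℝ ∞ u Ω := (π.contDiff.comp_contDiffOn hF.fst).prodMk hF.snd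
  have hup : ∀ X, fderiv ℝ u p X = (π (D X).1, (D X).2) := fun X => by
    have h1 : HasFDerivAt u _ p :=
      (π.hasFDerivAt.comp p hFp.hasFDerivAt.fst).prodMk hFp.hasFDerivAt.snd
    rw [h1.fderiv]
    rfl
  have huinj : Function.Injective (fderiv ℝ u p) := by
    rw [← ContinuousLinearMap.coe_coe, ← LinearMap.ker_eq_bot, LinearMap.ker_eq_bot']
    intro X hX
    rw [ContinuousLinearMap.coe_coe, hup] at hX
    have h1 : X ∈ LinearMap.ker l := congrArg Prod.snd hX
    have h2 : j (π₀ (L ⟨X, h1⟩)) = 0 := congrArg Prod.fst hX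
    have h3 : π₀ (L ⟨X, h1⟩) = ⟨X, h1⟩ := DFunLike.congr_fun hπ₀ _
    rw [h3, LinearEquiv.map_eq_zero_iff] at h2
    exact congrArg Subtype.val h2
  obtain ⟨e, he₀, heΩ, heu, -, hes⟩ := exists_openPartialHomeomorph_of_injective
    (by rw [hdim, Module.finrank_prod, Module.finrank_self]) hΩ hu hp huinj
  exact ⟨π, e, he₀, heΩ, fun z => by rw [heu], heu ▸ hu.mono heΩ, hes⟩

variable {E H M : Type*} [NormedAddCommGroup E] [NormedSpace ℝ E] [TopologicalSpace M]
  {F : Type*} [NormedAddCommGroup F] [NormedSpace ℝ F] [TopologicalSpace H]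
  {I : ModelWithCorners ℝ F H} [ChartedSpace H M]

/-- A coordinate system restricts to a parametrization of an open set by a product. -/
theorem exists_product_parametrization (e : OpenPartialHomeomorph M (E × ℝ))
    (he : ContMDiffOn I 𝓘(ℝ, E × ℝ) ∞ e e.source)
    (he' : ContMDiffOn 𝓘(ℝ, E × ℝ) I ∞ e.symm e.target) (N : TopologicalSpace.Opens E)
    (hN : Nonempty N) {J : Set ℝ} (hJ : IsOpen J) (hNJ : (N : Set E) ×ˢ J ⊆ e.target) :
    ∃ ψ : OpenPartialHomeomorph (N × ℝ) M, ψ.source = Set.univ ×ˢ J ∧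
      (∀ q, ψ q = e.symm ((q.1 : E), q.2)) ∧
      ContMDiffOn (𝓘(ℝ, E).prod 𝓘(ℝ, ℝ)) I ∞ ψ ψ.source ∧
      ContMDiffOn I (𝓘(ℝ, E).prod 𝓘(ℝ, ℝ)) ∞ ψ.symm ψ.target := by
  let i : OpenPartialHomeomorph (N × ℝ) (E × ℝ) :=
    (N.openPartialHomeomorphSubtypeCoe hN).prod (OpenPartialHomeomorph.refl ℝ)
  have hi : ∀ q, i q = ((q.1 : E), q.2) := fun q => rfl
  have hUJ : IsOpen ((Set.univ : Set N) ×ˢ J) := isOpen_univ.prod hJ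
  let ψ := (i.trans e.symm).restrOpen _ hUJ
  have hψ : ∀ q, ψ q = e.symm ((q.1 : E), q.2) := fun q => rfl
  have hsource : ψ.source = Set.univ ×ˢ J := by
    ext q
    have hq : q ∈ ψ.source ↔ q ∈ (i.trans e.symm).source ∩ Set.univ ×ˢ J := by
      rw [← OpenPartialHomeomorph.restrOpen_source]
    rw [hq]
    refine ⟨fun h => h.2, fun h => ⟨?_, h⟩⟩
    rw [OpenPartialHomeomorph.trans_source]
    refine ⟨by simp [i], ?_⟩
    exact hNJ ⟨q.1.2, h.2⟩
  have hmaps : Set.MapsTo (fun q : N × ℝ => ((q.1 : E), q.2)) ψ.source e.target := by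
    rw [hsource]
    exact fun q hq => hNJ ⟨q.1.2, hq.2⟩
  have hsymm : ∀ x ∈ ψ.target, x ∈ e.source ∧ ((ψ.symm x).1 : E) = (e x).1 ∧
      (ψ.symm x).2 = (e x).2 := by
    intro x hx
    have h1 := ψ.map_target hx
    have h2 := ψ.right_inv hx
    rw [hψ] at h2
    have h3 := e.right_inv (hmaps h1)
    refine ⟨?_, ?_, ?_⟩
    · rw [← h2]; exact e.map_target (hmaps h1)
    · rw [h2] at h3; rw [h3]
    · rw [h2] at h3; rw [h3]
  refine ⟨ψ, hsource, hψ, ?_, ?_⟩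
  · have hval : ContMDiff (𝓘(ℝ, E).prod 𝓘(ℝ, ℝ)) 𝓘(ℝ, E × ℝ) ∞
        (fun q : N × ℝ => ((q.1 : E), q.2)) :=
      (contMDiff_subtype_val.comp contMDiff_fst).prodMk_space contMDiff_snd
    exact he'.comp hval.contMDiffOn hmaps
  · have he1 : ContMDiffOn I 𝓘(ℝ, E × ℝ) ∞ e ψ.target := he.mono fun x hx => (hsymm x hx).1
    have h1 : ContMDiffOn I 𝓘(ℝ, E) ∞ (fun x => (ψ.symm x).1) ψ.target := by
      intro x hx
      rw [← ContMDiffWithinAt.subtypeVal_comp_iff]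
      refine ContMDiffWithinAt.congr (f := fun x => (e x).1) ?_ (fun y hy => (hsymm y hy).2.1)
        (hsymm x hx).2.1
      exact contDiff_fst.contMDiff.contMDiffAt.comp_contMDiffWithinAt x (he1 x hx)
    have h2 : ContMDiffOn I 𝓘(ℝ, ℝ) ∞ (fun x => (ψ.symm x).2) ψ.target := by
      intro x hx
      refine ContMDiffWithinAt.congr (f := fun x => (e x).2) ?_ (fun y hy => (hsymm y hy).2.2)
        (hsymm x hx).2.2
      exact contDiff_snd.contMDiff.contMDiffAt.comp_contMDiffWithinAt x (he1 x hx)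
    exact h1.prodMk h2

/-- The preferred chart of an open subset of `E` is the inclusion, so both derivatives are those of
the same map near `y`. -/
theorem differential_comp_subtype_val {N : TopologicalSpace.Opens E} {G : E → F} {y : N}
    (hG : ContDiffAt ℝ ∞ G y) :
    differential 𝓘(ℝ, E) (fun x : N => G x) y = fderiv ℝ G y := by
  have hmd : ContMDiffAt 𝓘(ℝ, E) 𝓘(ℝ, F) ∞ (fun x : N => G x) y :=
    contMDiffAt_subtype_iff.2 hG.contMDiffAt
  rw [differential_eq_fderiv (hmd.mdifferentiableAt (by simp))]
  have hy : extChartAt 𝓘(ℝ, E) y y = (y : E) := rfl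
  rw [hy]
  refine Filter.EventuallyEq.fderiv_eq ?_
  have ht : (extChartAt 𝓘(ℝ, E) y).target ∈ 𝓝 (y : E) :=
    extChartAt_target_mem_nhds (I := 𝓘(ℝ, E)) y
  filter_upwards [ht] with z hz
  have h1 := (extChartAt 𝓘(ℝ, E) y).right_inv hz
  exact congrArg G h1

end Coordinates

/-! ### Every immersion in class `𝒜` is locally a partial tube. -/

section Converse

variable {ε : SignType} {n : ℕ}

theorem exists_partialTube_parametrization {p m : ℕ} (hm : m = p + 1) {M : Type*}
    [TopologicalSpace M] [ChartedSpace (EuclideanSpace ℝ (Fin m)) M] [IsManifold (𝓡 m) ∞ M]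
    {f : M → Flat n × ℝ} (hf : InClassA (𝓡 m) ε f) (x₀ : M) :
    ∃ (k : ℕ) (N : TopologicalSpace.Opens (EuclideanSpace ℝ (Fin p)))
      (g : N → Flat n) (ξ : Fin k → N → Flat n) (J : Set ℝ) (α : ℝ → Flat k × ℝ)
      (ψ : OpenPartialHomeomorph (N × ℝ) M),
      IsPartialTubeData (𝓡 p) ε g ξ J α ∧ ψ.source = Set.univ ×ˢ J ∧ x₀ ∈ ψ.target ∧
      ContMDiffOn ((𝓡 p).prod 𝓘(ℝ, ℝ)) (𝓡 m) ∞ ψ ψ.source ∧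
      ContMDiffOn (𝓡 m) ((𝓡 p).prod 𝓘(ℝ, ℝ)) ∞ ψ.symm ψ.target ∧
      ∀ q ∈ ψ.source, f (ψ q) = partialTube g ξ α q := by
  let c := chartAt (EuclideanSpace ℝ (Fin m)) x₀
  have hc : ContMDiffOn (𝓡 m) (𝓡 m) ∞ c c.source := contMDiffOn_chart
  have hc' : ContMDiffOn (𝓡 m) (𝓡 m) ∞ c.symm c.target := contMDiffOn_chart_symm
  have hx₀ : x₀ ∈ c.source := mem_chart_source _ x₀
  have hfs : ContMDiff (𝓡 m) 𝓘(ℝ, Flat n × ℝ) ∞ f := fun x => (hf x).smooth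
  have hfm : ∀ x, f x ∈ productSpace ε n := fun x => (hf x).mem.self_of_nhds
  obtain ⟨π, e₁, he₁x, he₁c, he₁, he₁s, he₁s'⟩ := exists_height_coordinates
    (E := EuclideanSpace ℝ (Fin p)) (by simp [hm]) c.open_target
    (contMDiffOn_iff_contDiffOn.1 (hfs.comp_contMDiffOn hc')) (fun z _ => hfm _)
    (c.map_source hx₀) ((hf x₀).of_coordinates c hc hc' hx₀)
  let e := c.trans e₁
  have hes : ContMDiffOn (𝓡 m) 𝓘(ℝ, EuclideanSpace ℝ (Fin p) × ℝ) ∞ e e.source :=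
    he₁s.contMDiffOn.comp (hc.mono fun x hx => hx.1) fun x hx => hx.2
  have hes' : ContMDiffOn 𝓘(ℝ, EuclideanSpace ℝ (Fin p) × ℝ) (𝓡 m) ∞ e.symm e.target :=
    hc'.comp (he₁s'.contMDiffOn.mono fun x hx => hx.1) fun x hx => hx.2
  have hex₀ : x₀ ∈ e.source := ⟨hx₀, he₁x⟩
  have heval : ∀ x ∈ e.source, e x = (π (f x).1, (f x).2) := fun x hx => by
    change e₁ (c x) = _
    rw [he₁, Function.comp_apply, c.left_inv hx.1]
  let φ : EuclideanSpace ℝ (Fin p) × ℝ → Flat n := fun w => (f (e.symm w)).1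
  have hfφ : ∀ w ∈ e.target, π (φ w) = w.1 ∧ f (e.symm w) = (φ w, w.2) := fun w hw => by
    have h1 := heval _ (e.map_target hw)
    rw [e.right_inv hw] at h1
    exact ⟨(congrArg Prod.fst h1).symm, Prod.ext rfl (congrArg Prod.snd h1).symm⟩
  have hφs : ContDiffOn ℝ ∞ φ e.target :=
    (contMDiffOn_iff_contDiffOn.1 (hfs.comp_contMDiffOn hes')).fst
  have hφm : ∀ w ∈ e.target, φ w ∈ spaceForm ε n := fun w _ => hfm _
  obtain ⟨e₂, he₂x, he₂e, he₂s, he₂s', he₂h, he₂⟩ := exists_adapted_coordinates e.open_target hφs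
    hφm (fun w hw => (hfφ w hw).1) (fun w hw => by
      have h1 := (hf (e.symm w)).of_coordinates e hes hes' (e.map_target hw)
      rw [e.right_inv hw] at h1
      refine h1.congr ?_
      filter_upwards [e.open_target.mem_nhds hw] with v hv using (hfφ v hv).2)
    (e.map_source hex₀)
  set z₀ := e₂ (e x₀)
  obtain ⟨r, hr, hball⟩ := Metric.isOpen_iff.1 e₂.open_target z₀ (e₂.map_source he₂x)
  -- Balls of the sup metric are products of balls, which supplies both the slice domain and the
  -- interval.
  rw [← ball_prod_same] at hball
  have hJ := isAdapted_of_coordinates e.open_target hφs hφm e₂ he₂e he₂s' he₂ Metric.isOpen_ball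
    (convex_ball z₀.1 r).isPreconnected Metric.isOpen_ball (convex_ball z₀.2 r).isPreconnected hball
  set Φ := φ ∘ e₂.symm
  have hy₀ : z₀.1 ∈ Metric.ball z₀.1 r := Metric.mem_ball_self hr
  have hs₀ : z₀.2 ∈ Metric.ball z₀.2 r := Metric.mem_ball_self hr
  obtain ⟨k, ξ, v, hvs, hvm, hξs, hξt, hξn, hξo, hξp, heq⟩ := hJ.exists_tube hs₀ hy₀
  let N : TopologicalSpace.Opens (EuclideanSpace ℝ (Fin p)) :=
    ⟨Metric.ball z₀.1 r, Metric.isOpen_ball⟩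
  let e₃ := e.trans e₂
  have he₃t : e₂.target ⊆ e₃.target := fun w hw => ⟨hw, he₂e (e₂.map_target hw)⟩
  obtain ⟨ψ, hψs, hψ, hψc, hψc'⟩ := exists_product_parametrization (I := 𝓡 m) e₃
    (he₂s.contMDiffOn.comp (hes.mono fun x hx => hx.1) fun x hx => hx.2)
    (hes'.comp (he₂s'.contMDiffOn.mono fun x hx => hx.1) fun x hx => hx.2)
    N ⟨⟨z₀.1, hy₀⟩⟩ Metric.isOpen_ball (hball.trans he₃t)
  have hgd : ∀ y : N, differential (𝓡 p) (fun y : N => Φ (y, z₀.2)) y =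
      fderiv ℝ (fun x => Φ (x, z₀.2)) y := fun y =>
    differential_comp_subtype_val (hJ.contDiffAt_left y.2 hs₀)
  have hξd : ∀ i (y : N), differential (𝓡 p) (fun y : N => ξ i y) y = fderiv ℝ (ξ i) y :=
    fun i y => differential_comp_subtype_val (hξs y y.2 i)
  -- The curve is parametrized by the height, so its last component has derivative `1` and
  -- regularity is automatic.
  refine ⟨k, N, fun y => Φ (y, z₀.2), fun i y => ξ i y, Metric.ball z₀.2 r, fun s => (v s, s), ψ,
    ?_, hψs, ?_, hψc, hψc', ?_⟩
  · exact {
      smooth_g := fun y => contMDiffAt_subtype_iff.2 (hJ.contDiffAt_left y.2 hs₀).contMDiffAt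
      mem_g := fun y => hJ.mem y y.2 _ hs₀
      immersion_g := fun y => by
        rw [hgd, ← ContinuousLinearMap.coe_coe, ← LinearMap.ker_eq_bot, LinearMap.ker_eq_bot']
        intro Z hZ
        rw [ContinuousLinearMap.coe_coe, hJ.fderiv_left y.2 hs₀] at hZ
        exact hJ.injective y y.2 _ hs₀ Z hZ
      smooth_ξ := fun i y => contMDiffAt_subtype_iff.2 (hξs y y.2 i).contMDiffAt
      normal_ξ := fun i y => ⟨hξt y y.2 i, fun X => by
        rw [hgd]
        exact hξn y y.2 i X⟩
      orthonormal_ξ := fun i j y => hξo y y.2 i j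
      parallel_ξ := fun i y X ζ hζ => by
        obtain ⟨Z, hZ⟩ := hξp y y.2 i X
        rw [hξd, hZ, ← hgd]
        exact hζ.2 Z
      isOpen_J := Metric.isOpen_ball
      interval_J := (convex_ball z₀.2 r).ordConnected
      smooth_α := hvs.prodMk contDiffOn_id
      mem_α := hvm
      regular_α := fun s hs h0 => by
        have h1 : HasDerivAt (fun s => (v s, s)) _ s := ((hvs.contDiffAt
          (Metric.isOpen_ball.mem_nhds hs)).differentiableAt (by simp)).hasDerivAt.prodMk
          (hasDerivAt_id s)
        rw [h1.deriv] at h0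
        exact one_ne_zero (congrArg Prod.snd h0)
      deriv_last := fun s _ => by
        rw [show (fun u : ℝ => u) = id from rfl, deriv_id]
        exact one_ne_zero }
  · have h1 : ((⟨z₀.1, hy₀⟩, z₀.2) : N × ℝ) ∈ ψ.source := by
      rw [hψs]; exact ⟨Set.mem_univ _, hs₀⟩
    have h2 := ψ.map_source h1
    rw [hψ] at h2
    have h3 : e₃.symm z₀ = x₀ := e₃.left_inv ⟨hex₀, he₂x⟩
    rwa [show (((⟨z₀.1, hy₀⟩ : N) : EuclideanSpace ℝ (Fin p)), z₀.2) = z₀ from rfl, h3] at h2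
  · rintro ⟨y, s⟩ hq
    rw [hψs] at hq
    have hw : ((y : EuclideanSpace ℝ (Fin p)), s) ∈ e₂.target := hball ⟨y.2, hq.2⟩
    have h1 : f (ψ (y, s)) = (Φ (y, s), s) := by
      rw [hψ]
      change f (e.symm (e₂.symm (y, s))) = _
      rw [(hfφ _ (he₂e (e₂.map_target hw))).2, ← he₂h, e₂.right_inv hw]
      rfl
    rw [h1, heq y y.2 s hq.2]
    simp [partialTube, verticalField, Prod.ext_iff, Prod.fst_sum, Prod.snd_sum]

end Converse

/-! ### From an orthogonal direction to an eigenvector of all shape operators. -/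

section Eigenvector

variable {ε : SignType} {n : ℕ} {E : Type*} [NormedAddCommGroup E] [NormedSpace ℝ E]
  [FiniteDimensional ℝ E]

/-- If the line `0 × ℝ` is orthogonal to `E × 0`, with respect to the metric induced by `D`, and
to the second fundamental form `H`, then it is spanned by the tangential part of `∂/∂t`, which is
an eigenvector of all shape operators. -/
theorem exists_vertical_eigenvector {q : Flat n} (hq : q ∈ spaceForm ε n)
    (D : E × ℝ →L[ℝ] Flat n × ℝ) (H : E × ℝ →L[ℝ] E × ℝ →L[ℝ] Flat n × ℝ)
    (hinj : Function.Injective D) (htan : ∀ X, (D X).1 ∈ tangentSpaceForm ε q)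
    (hne : (D (0, 1)).2 ≠ 0) (hlevel : ∀ X : E, (D (X, 0)).2 = 0)
    (hort : ∀ X : E, flatForm ε n (D (0, 1)).1 (D (X, 0)).1 = 0)
    (hH : ∀ X : E, ∃ X' : E, H (0, 1) (X, 0) = D (X', 0)) :
    ∃ T : E × ℝ, (verticalField n - D T).1 ∈ tangentSpaceForm ε q ∧
      (∀ X, flatInnerProd ε (D X) (verticalField n - D T) = 0) ∧ T ≠ 0 ∧
      ∀ ζ : Flat n × ℝ, ζ.1 ∈ tangentSpaceForm ε q → (∀ X, flatInnerProd ε (D X) ζ = 0) →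
        ∃ A : (E × ℝ) →ₗ[ℝ] (E × ℝ),
          (∀ X Y, flatInnerProd ε (D (A X)) (D Y) = flatInnerProd ε (H X Y) ζ) ∧
          ∃ c : ℝ, Module.End.HasEigenvector A c T := by
  set w := (D (0, 1)).1 with hw
  set a := (D (0, 1)).2 with ha
  set Q := flatForm ε n w w + a * a with hQdef
  have hQ : 0 < Q := add_pos_of_nonneg_of_pos (flatForm_self_nonneg hq (htan _))
    (mul_self_pos.2 hne)
  have hdec : ∀ Y : E × ℝ, Y = (Y.1, 0) + Y.2 • ((0, 1) : E × ℝ) := fun Y => by ext <;> simp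
  have hDD : ∀ Y : E × ℝ, flatInnerProd ε (D (0, 1)) (D Y) = Y.2 * Q := fun Y => by
    rw [flatInnerProd_eq]
    conv_lhs => rw [hdec Y]
    rw [map_add, map_smul, Prod.fst_add, Prod.snd_add, Prod.smul_fst, Prod.smul_snd, map_add,
      map_smul, hort, hlevel, ← hw, ← ha, hQdef]
    simp only [smul_eq_mul]
    ring
  have hDsnd : ∀ Y : E × ℝ, (D Y).2 = Y.2 * a := fun Y => by
    conv_lhs => rw [hdec Y]
    rw [map_add, map_smul, Prod.snd_add, Prod.smul_snd, hlevel, ← ha]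
    simp
  -- `T` represents the height differential: `(0, 1)` has squared length `Q` and height derivative
  -- `a`, and height does not vary along `E × 0`.
  let T : E × ℝ := (a / Q) • (0, 1)
  have hτ : a / Q ≠ 0 := div_ne_zero hne hQ.ne'
  have hT0 : T ≠ 0 := smul_ne_zero hτ fun h => one_ne_zero (congrArg Prod.snd h)
  have hDT : D T = (a / Q) • D (0, 1) := map_smul D _ _
  refine ⟨T, ?_, fun X => ?_, hT0, fun ζ hζ hζn => ?_⟩
  · rw [Prod.fst_sub, verticalField, zero_sub]
    exact (tangentSubmodule ε q).neg_mem (htan T)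
  · have h1 := hDD X
    rw [flatInnerProd_eq, flatForm_comm] at h1
    rw [flatInnerProd_eq, hDT, Prod.fst_sub, Prod.snd_sub, Prod.smul_fst, Prod.smul_snd,
      verticalField, zero_sub, map_neg, map_smul]
    simp only [smul_eq_mul]
    have h2 := hDsnd X
    field_simp
    linear_combination -a * h1 + Q * h2
  · let B : (E × ℝ) →ₗ[ℝ] (E × ℝ) →ₗ[ℝ] ℝ := LinearMap.mk₂ ℝ
      (fun X Y => flatInnerProd ε (D X) (D Y))
      (fun _ _ _ => by simp [flatInnerProd_eq]; ring) (fun _ _ _ => by simp [flatInnerProd_eq]; ring)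
      (fun _ _ _ => by simp [flatInnerProd_eq]; ring) (fun _ _ _ => by simp [flatInnerProd_eq]; ring)
    let C : (E × ℝ) →ₗ[ℝ] (E × ℝ) →ₗ[ℝ] ℝ := LinearMap.mk₂ ℝ
      (fun X Y => flatInnerProd ε (H X Y) ζ)
      (fun _ _ _ => by simp [flatInnerProd_eq]; ring) (fun _ _ _ => by simp [flatInnerProd_eq]; ring)
      (fun _ _ _ => by simp [flatInnerProd_eq]; ring) (fun _ _ _ => by simp [flatInnerProd_eq]; ring)
    have hB : ∀ X, B X X = 0 → X = 0 := fun X hX => by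
      have h1 : flatForm ε n (D X).1 (D X).1 + (D X).2 * (D X).2 = 0 := hX
      have h2 := flatForm_self_nonneg hq (htan X)
      have h3 := mul_self_nonneg (D X).2
      exact hinj ((Prod.ext (eq_zero_of_flatForm_self hq (htan X) (by linarith))
        (mul_self_eq_zero.1 (by linarith))).trans (map_zero D).symm)
    obtain ⟨R, hR⟩ := exists_riesz_equiv B hB
    refine ⟨R.toLinearMap ∘ₗ C, fun X Y => hR (C X) Y,
      -- The eigenvalue is the normal curvature of the line `0 × ℝ` in the direction `ζ`, normalized
      -- by the squared length.
      flatInnerProd ε (H (0, 1) (0, 1)) ζ / Q, Module.End.hasEigenvector_iff.2 ⟨?_, hT0⟩⟩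
    rw [Module.End.mem_eigenspace_iff]
    have hC : ∀ Y : E × ℝ, C (0, 1) Y = Y.2 * flatInnerProd ε (H (0, 1) (0, 1)) ζ := fun Y => by
      obtain ⟨X', hX'⟩ := hH Y.1
      have h0 : C (0, 1) (Y.1, 0) = 0 := by
        change flatInnerProd ε (H (0, 1) (Y.1, 0)) ζ = 0
        rw [hX', hζn]
      conv_lhs => rw [hdec Y]
      rw [map_add, map_smul, h0, zero_add]
      rfl
    have hRC : R (C (0, 1)) = (flatInnerProd ε (H (0, 1) (0, 1)) ζ / Q) • (0, 1) := by
      rw [← sub_eq_zero]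
      refine hB _ ?_
      have h1 : ∀ Y, B (R (C (0, 1)) - (flatInnerProd ε (H (0, 1) (0, 1)) ζ / Q) • (0, 1)) Y = 0 :=
        fun Y => by
          have h2 : B (0, 1) Y = Y.2 * Q := hDD Y
          rw [map_sub, map_smul, LinearMap.sub_apply, LinearMap.smul_apply, hR, hC, h2, smul_eq_mul]
          field_simp
          ring
      exact h1 _
    change R (C ((a / Q) • (0, 1))) = _
    rw [map_smul, map_smul, hRC, smul_comm]

end Eigenvector

/-! ### Partial tubes are in class `𝒜` at their regular points. -/

section Direct

variable {ε : SignType} {n k : ℕ} {E : Type*} [NormedAddCommGroup E] [NormedSpace ℝ E]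
  {H : Type*} [TopologicalSpace H] {I : ModelWithCorners ℝ E H} {N : Type*} [TopologicalSpace N]
  [ChartedSpace H N] {g : N → Flat n} {ξ : Fin k → N → Flat n} {J : Set ℝ} {α : ℝ → Flat k × ℝ}

theorem partialTube_fst {P : Type*} (g : P → Flat n) (ξ : Fin k → P → Flat n)
    (α : ℝ → Flat k × ℝ) (q : P × ℝ) : (partialTube g ξ α q).1 =
      (α q.2).1 0 • g q.1 + ∑ i, (α q.2).1 i.succ • ξ i q.1 := by
  simp [partialTube, verticalField, Prod.fst_sum]

theorem partialTube_snd {P : Type*} (g : P → Flat n) (ξ : Fin k → P → Flat n)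
    (α : ℝ → Flat k × ℝ) (q : P × ℝ) : (partialTube g ξ α q).2 = (α q.2).2 := by
  simp [partialTube, verticalField, Prod.snd_sum]

theorem partialTube_eq {P : Type*} (g : P → Flat n) (ξ : Fin k → P → Flat n)
    (α : ℝ → Flat k × ℝ) (q : P × ℝ) : partialTube g ξ α q =
      ((α q.2).1 0 • g q.1 + ∑ i, (α q.2).1 i.succ • ξ i q.1, (α q.2).2) :=
  Prod.ext (partialTube_fst g ξ α q) (partialTube_snd g ξ α q)

theorem hasDerivAt_frame {W : Type*} [NormedAddCommGroup W] [NormedSpace ℝ W] {s : ℝ}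
    (hα : DifferentiableAt ℝ α s) (w : W) (u : Fin k → W) :
    HasDerivAt (fun t => (α t).1 0 • w + ∑ i, (α t).1 i.succ • u i)
      ((deriv α s).1 0 • w + ∑ i, (deriv α s).1 i.succ • u i) s := by
  have hj : ∀ j, HasDerivAt (fun t => (α t).1 j) ((deriv α s).1 j) s := fun j =>
    ((ContinuousLinearMap.proj (R := ℝ) (φ := fun _ => ℝ) j).comp
      (ContinuousLinearMap.fst ℝ (Flat k) ℝ)).hasFDerivAt.comp_hasDerivAt s hα.hasDerivAt
  exact ((hj 0).smul_const w).add (HasDerivAt.fun_sum fun i _ => (hj i.succ).smul_const (u i))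

section VectorSpace

variable {g' : E → Flat n} {ξ' : Fin k → E → Flat n} {u : E} {s : ℝ}

theorem contDiffAt_partialTube (hg : ContDiffAt ℝ ∞ g' u) (hξ : ∀ i, ContDiffAt ℝ ∞ (ξ' i) u)
    (hα : ContDiffAt ℝ ∞ α s) : ContDiffAt ℝ ∞ (partialTube g' ξ' α) (u, s) := by
  have hα' : ContDiffAt ℝ ∞ (fun q : E × ℝ => α q.2) (u, s) := hα.comp (u, s) contDiffAt_snd
  have hα1 : ∀ j, ContDiffAt ℝ ∞ (fun q : E × ℝ => (α q.2).1 j) (u, s) := fun j =>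
    contDiffAt_pi.1 hα'.fst j
  rw [funext (partialTube_eq g' ξ' α)]
  refine ContDiffAt.prodMk (ContDiffAt.add ((hα1 0).smul (hg.comp (u, s) contDiffAt_fst)) ?_)
    hα'.snd
  exact ContDiffAt.sum fun i _ => (hα1 i.succ).smul ((hξ i).comp (u, s) contDiffAt_fst)

theorem fderiv_partialTube_left (hg : ContDiffAt ℝ ∞ g' u) (hξ : ∀ i, ContDiffAt ℝ ∞ (ξ' i) u)
    (hα : ContDiffAt ℝ ∞ α s) (X : E) : fderiv ℝ (partialTube g' ξ' α) (u, s) (X, 0) =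
      ((α s).1 0 • fderiv ℝ g' u X + ∑ i, (α s).1 i.succ • fderiv ℝ (ξ' i) u X, 0) := by
  have h1 := hasFDerivAt_slice_left
    ((contDiffAt_partialTube hg hξ hα).differentiableAt (by simp))
  have h2 : HasFDerivAt (fun y => partialTube g' ξ' α (y, s))
      (((α s).1 0 • fderiv ℝ g' u + ∑ i, (α s).1 i.succ • fderiv ℝ (ξ' i) u).prod 0) u := by
    simp only [partialTube_eq]
    exact (((hg.differentiableAt (by simp)).hasFDerivAt.const_smul ((α s).1 0)).add
      (HasFDerivAt.fun_sum fun i _ =>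
        ((hξ i).differentiableAt (by simp)).hasFDerivAt.const_smul ((α s).1 i.succ))).prodMk
      (hasFDerivAt_const (α s).2 u)
  have h3 := DFunLike.congr_fun (h1.unique h2) X
  simpa using h3

theorem fderiv_partialTube_right (hg : ContDiffAt ℝ ∞ g' u) (hξ : ∀ i, ContDiffAt ℝ ∞ (ξ' i) u)
    (hα : ContDiffAt ℝ ∞ α s) : fderiv ℝ (partialTube g' ξ' α) (u, s) (0, 1) =
      ((deriv α s).1 0 • g' u + ∑ i, (deriv α s).1 i.succ • ξ' i u, (deriv α s).2) := by
  have hαd := hα.differentiableAt (by simp)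
  refine (hasDerivAt_slice_right
    ((contDiffAt_partialTube hg hξ hα).differentiableAt (by simp))).unique ?_
  simp only [partialTube_eq]
  exact (hasDerivAt_frame hαd _ _).prodMk
    ((ContinuousLinearMap.snd ℝ (Flat k) ℝ).hasFDerivAt.comp_hasDerivAt s hαd.hasDerivAt)

/-- Only the coefficients depend on `s`, so the mixed derivative has the shape of the first
derivative along `N`, with `α` replaced by `α'`. -/
theorem fderiv_fderiv_partialTube (hg : ContDiffAt ℝ ∞ g' u) (hξ : ∀ i, ContDiffAt ℝ ∞ (ξ' i) u)
    (hα : ∀ᶠ t in 𝓝 s, ContDiffAt ℝ ∞ α t) (X : E) :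
    fderiv ℝ (fderiv ℝ (partialTube g' ξ' α)) (u, s) (0, 1) (X, 0) =
      ((deriv α s).1 0 • fderiv ℝ g' u X + ∑ i, (deriv α s).1 i.succ • fderiv ℝ (ξ' i) u X,
        0) := by
  have hF := contDiffAt_partialTube hg hξ hα.self_of_nhds
  rw [← fderiv_fderiv_apply hF]
  refine (hasDerivAt_slice_right (differentiableAt_fderiv_apply hF (X, 0))).unique ?_
  refine HasDerivAt.congr_of_eventuallyEq ?_
    (hα.mono fun t ht => fderiv_partialTube_left hg hξ ht X)
  exact (hasDerivAt_frame (hα.self_of_nhds.differentiableAt (by simp)) _ _).prodMk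
    (hasDerivAt_const s (0 : ℝ))

end VectorSpace

namespace IsPartialTubeData

theorem partialTube_mem (h : IsPartialTubeData I ε g ξ J α) (x : N) {s : ℝ} (hs : s ∈ J) :
    partialTube g ξ α (x, s) ∈ productSpace ε n := by
  change (partialTube g ξ α (x, s)).1 ∈ spaceForm ε n
  rw [partialTube_fst]
  exact (frame_mem_spaceForm_iff (h.mem_g x) (fun i => (h.normal_ξ i x).1)
    (fun i j => h.orthonormal_ξ i j x) _).2 (h.mem_α s hs)

theorem contDiffAt_α (h : IsPartialTubeData I ε g ξ J α) {s : ℝ} (hs : s ∈ J) :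
    ContDiffAt ℝ ∞ α s := h.smooth_α.contDiffAt (h.isOpen_J.mem_nhds hs)

theorem contMDiffAt_partialTube (h : IsPartialTubeData I ε g ξ J α) (x : N) {s : ℝ} (hs : s ∈ J) :
    ContMDiffAt (I.prod 𝓘(ℝ, ℝ)) 𝓘(ℝ, Flat n × ℝ) ∞ (partialTube g ξ α) (x, s) := by
  have hα : ContMDiffAt (I.prod 𝓘(ℝ, ℝ)) 𝓘(ℝ, Flat k × ℝ) ∞ (fun q : N × ℝ => α q.2) (x, s) :=
    (h.contDiffAt_α hs).contMDiffAt.comp (x, s) contMDiffAt_snd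
  have hα1 : ∀ j, ContMDiffAt (I.prod 𝓘(ℝ, ℝ)) 𝓘(ℝ, ℝ) ∞ (fun q : N × ℝ => (α q.2).1 j) (x, s) :=
    fun j => ((contDiff_apply ℝ ℝ j).comp contDiff_fst).contMDiff.contMDiffAt.comp (x, s) hα
  have hα2 : ContMDiffAt (I.prod 𝓘(ℝ, ℝ)) 𝓘(ℝ, ℝ) ∞ (fun q : N × ℝ => (α q.2).2) (x, s) :=
    contDiff_snd.contMDiff.contMDiffAt.comp (x, s) hα
  have hg : ContMDiffAt (I.prod 𝓘(ℝ, ℝ)) 𝓘(ℝ, Flat n) ∞ (fun q : N × ℝ => g q.1) (x, s) :=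
    (h.smooth_g x).comp (x, s) contMDiffAt_fst
  have hξ : ∀ i, ContMDiffAt (I.prod 𝓘(ℝ, ℝ)) 𝓘(ℝ, Flat n) ∞ (fun q : N × ℝ => ξ i q.1) (x, s) :=
    fun i => (h.smooth_ξ i x).comp (x, s) contMDiffAt_fst
  rw [funext (partialTube_eq g ξ α)]
  refine ContMDiffAt.prodMk_space (ContMDiffAt.add ((hα1 0).smul hg) ?_) hα2
  exact ContMDiffAt.sum fun i _ => (hα1 i.succ).smul (hξ i)

variable [I.Boundaryless] [IsManifold I ∞ N]

theorem inClassAAt_partialTube [FiniteDimensional ℝ E] (h : IsPartialTubeData I ε g ξ J α) (x : N)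
    {s : ℝ} (hs : s ∈ J)
    (himm : Function.Injective (differential (I.prod 𝓘(ℝ, ℝ)) (partialTube g ξ α) (x, s))) :
    InClassAAt (I.prod 𝓘(ℝ, ℝ)) ε (partialTube g ξ α) (x, s) := by
  have hsmooth := h.contMDiffAt_partialTube x hs
  have hJ : ∀ᶠ t in 𝓝 s, t ∈ J := h.isOpen_J.mem_nhds hs
  have hmem : ∀ᶠ q in 𝓝 (x, s), partialTube g ξ α q ∈ productSpace ε n := by
    filter_upwards [continuousAt_snd.eventually hJ] with q hq using h.partialTube_mem q.1 hq
  refine ⟨hsmooth, hmem, himm, ?_⟩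
  set c := extChartAt I x
  have hcs : ContMDiffAt 𝓘(ℝ, E) I ∞ c.symm (c x) :=
    (contMDiffOn_extChartAt_symm x).contMDiffAt (extChartAt_target_mem_nhds x)
  have hcx : c.symm (c x) = x := extChartAt_to_inv x
  let g' : E → Flat n := g ∘ c.symm
  let ξ' : Fin k → E → Flat n := fun i => ξ i ∘ c.symm
  have hg' : ContDiffAt ℝ ∞ g' (c x) := contMDiffAt_iff_contDiffAt.1
    ((h.smooth_g _).comp (c x) hcs)
  have hξ' : ∀ i, ContDiffAt ℝ ∞ (ξ' i) (c x) := fun i => contMDiffAt_iff_contDiffAt.1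
    ((h.smooth_ξ i _).comp (c x) hcs)
  have hg'd := hg'.differentiableAt (by simp)
  have hξ'd := fun i => (hξ' i).differentiableAt (n := ∞) (by simp)
  have hg'x : g' (c x) = g x := congrArg g hcx
  have hξ'x : ∀ i, ξ' i (c x) = ξ i x := fun i => congrArg (ξ i) hcx
  set F : E × ℝ → Flat n × ℝ := partialTube g' ξ' α with hF
  have hFc : partialTube g ξ α ∘ (extChartAt (I.prod 𝓘(ℝ, ℝ)) (x, s)).symm = F := by
    rw [extChartAt_prod]
    rfl
  have hcxs : extChartAt (I.prod 𝓘(ℝ, ℝ)) (x, s) (x, s) = (c x, s) := by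
    rw [extChartAt_prod]
    rfl
  have hαs := h.contDiffAt_α hs
  have hFs : ContDiffAt ℝ ∞ F (c x, s) := contDiffAt_partialTube hg' hξ' hαs
  have hdF := differential_eq_fderiv (hsmooth.mdifferentiableAt (by simp))
  rw [hFc, hcxs] at hdF
  have hdg : differential I g x = fderiv ℝ g' (c x) :=
    differential_eq_fderiv ((h.smooth_g x).mdifferentiableAt (by simp))
  have hdξ : ∀ i, differential I (ξ i) x = fderiv ℝ (ξ' i) (c x) := fun i =>
    differential_eq_fderiv ((h.smooth_ξ i x).mdifferentiableAt (by simp))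
  set L := fderiv ℝ g' (c x) with hL
  have hLinj : Function.Injective L := hdg ▸ h.immersion_g x
  have hLtan : ∀ X, L X ∈ tangentSpaceForm ε (g x) := fun X => by
    rw [← hg'x]
    exact fderiv_mem_tangentSpaceForm hg'd (Filter.Eventually.of_forall fun u => h.mem_g _) X
  have hLξ : ∀ i X, flatForm ε n (L X) (ξ i x) = 0 := fun i X => by
    rw [← hdg]
    exact (h.normal_ξ i x).2 X
  -- Parallelism removes the components normal to `g` in `ℚ_ε^n`; the component normal to `ℚ_ε^n`
  -- vanishes because `ξ_i` is orthogonal to `g_* X`.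
  have hξL : ∀ i X, fderiv ℝ (ξ' i) (c x) X ∈ LinearMap.range L.toLinearMap := fun i X => by
    refine mem_range_of_orthogonal (h.mem_g x) L.toLinearMap hLinj hLtan ?_ fun ζ hζ hζn => ?_
    · rw [← hg'x]
      refine fderiv_section_mem_tangentSpaceForm hg'd (hξ'd i)
        (Filter.Eventually.of_forall fun u => (h.normal_ξ i _).1) ?_
      rw [hξ'x]
      exact hLξ i X
    · rw [← hdξ]
      refine h.parallel_ξ i x X ζ ⟨hζ, fun Y => ?_⟩
      rw [hdg]
      exact hζn Y
  have hPL : ∀ (v : Flat k) X, v 0 • L X + ∑ i, v (Fin.succ i) • fderiv ℝ (ξ' i) (c x) X ∈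
      LinearMap.range L.toLinearMap := fun v X =>
    Submodule.add_mem _ (Submodule.smul_mem _ _ ⟨X, rfl⟩)
      (Submodule.sum_mem _ fun i _ => Submodule.smul_mem _ _ (hξL i X))
  have hD0 := fderiv_partialTube_left hg' hξ' hαs
  have hD1 := fderiv_partialTube_right hg' hξ' hαs
  rw [hg'x] at hD1
  simp only [hξ'x] at hD1
  rw [← hF] at hD1
  simp only [← hF, ← hL] at hD0
  rw [hdF] at himm
  -- Regularity enters here: the differential of the tube along `N` is injective into the range of
  -- `L`, which has the same dimension, so it is onto.
  have hLP : ∀ X, ∃ X', fderiv ℝ F (c x, s) (X', 0) = (L X, 0) := by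
    let P : E →ₗ[ℝ] Flat n := LinearMap.fst ℝ (Flat n) ℝ ∘ₗ
      (fderiv ℝ F (c x, s)).toLinearMap ∘ₗ LinearMap.inl ℝ E ℝ
    have hP : ∀ X, P X = (fderiv ℝ F (c x, s) (X, 0)).1 := fun X => rfl
    have hPinj : Function.Injective P := by
      rw [← LinearMap.ker_eq_bot, LinearMap.ker_eq_bot']
      intro X hX
      have h1 : fderiv ℝ F (c x, s) (X, 0) = fderiv ℝ F (c x, s) 0 := by
        rw [map_zero]
        exact Prod.ext hX (by rw [hD0]; rfl)
      exact congrArg Prod.fst (himm h1)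
    have hle : LinearMap.range P ≤ LinearMap.range L.toLinearMap := by
      rintro _ ⟨X, rfl⟩
      rw [hP, hD0]
      exact hPL _ X
    have heq := Submodule.eq_of_le_of_finrank_eq hle (by
      rw [LinearMap.finrank_range_of_inj hPinj, LinearMap.finrank_range_of_inj hLinj])
    intro X
    obtain ⟨X', hX'⟩ : L X ∈ LinearMap.range P := heq ▸ ⟨X, rfl⟩
    exact ⟨X', Prod.ext hX' (by rw [hD0])⟩
  -- If `ε = 0`, the position vector need not be orthogonal to `g_* X`, but `α_0` is identically
  -- `1`; otherwise the position vector is normal.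
  have hα0 : ∀ X, (deriv α s).1 0 * flatForm ε n (g x) (L X) = 0 := fun X => by
    rcases eq_or_ne ε 0 with rfl | hε
    · have h1 : (fun t => (α t).1 0) =ᶠ[𝓝 s] fun _ => (1 : ℝ) := hJ.mono fun t ht => h.mem_α t ht
      have h2 := (ContinuousLinearMap.proj (R := ℝ) (φ := fun _ : Fin (k + 1) => ℝ) 0 ∘L
        ContinuousLinearMap.fst ℝ (Flat k) ℝ).hasFDerivAt.comp_hasDerivAt s
        (hαs.differentiableAt (by simp)).hasDerivAt
      have h3 : (deriv α s).1 0 = 0 := h2.unique ((hasDerivAt_const s (1 : ℝ)).congr_of_eventuallyEq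
        h1)
      rw [h3, zero_mul]
    · rw [(mem_tangentSpaceForm_of_ne_zero hε).1 (hLtan X), mul_zero]
  have hwL : ∀ X, flatForm ε n ((deriv α s).1 0 • g x + ∑ i, (deriv α s).1 (Fin.succ i) • ξ i x)
      (L X) = 0 := fun X => by
    rw [map_add, map_smul, map_sum, _root_.add_apply, _root_.smul_apply, _root_.sum_apply,
      smul_eq_mul, hα0, zero_add]
    refine Finset.sum_eq_zero fun i _ => ?_
    rw [map_smul, _root_.smul_apply, flatForm_comm, hLξ, smul_zero]
  have hlast : (deriv α s).2 ≠ 0 := by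
    have h1 := (ContinuousLinearMap.snd ℝ (Flat k) ℝ).hasFDerivAt.comp_hasDerivAt s
      (hαs.differentiableAt (by simp)).hasDerivAt
    have h2 := h.deriv_last s hs
    rwa [show (fun u => (α u).2) = ContinuousLinearMap.snd ℝ (Flat k) ℝ ∘ α from rfl,
      h1.deriv] at h2
  have hFx : F (c x, s) = partialTube g ξ α (x, s) := by
    rw [hF, partialTube_eq, partialTube_eq]
    simp only [hg'x, hξ'x]
  have htan : ∀ X, (fderiv ℝ F (c x, s) X).1 ∈ tangentSpaceForm ε (partialTube g ξ α (x, s)).1 := by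
    intro X
    have hFd := hFs.differentiableAt (by simp)
    have h1 := fderiv_mem_tangentSpaceForm (ε := ε) (u := fun w => (F w).1) hFd.fst (by
      filter_upwards [continuousAt_snd.eventually hJ] with q hq
        using h.partialTube_mem (c.symm q.1) hq) X
    rw [fderiv.fst hFd, hFx] at h1
    exact h1
  obtain ⟨T, hT1, hT2, hT0, hA⟩ := exists_vertical_eigenvector (h.partialTube_mem x hs)
    (fderiv ℝ F (c x, s)) (fderiv ℝ (fderiv ℝ F) (c x, s)) himm htan (by rwa [hD1])
    (fun X => by rw [hD0]) (fun X => by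
      rw [hD0, hD1]
      obtain ⟨X', hX'⟩ := hPL (α s).1 X
      rw [← hX']
      exact hwL X') (fun X => by
      obtain ⟨Y, hY⟩ := hPL (deriv α s).1 X
      obtain ⟨X', hX'⟩ := hLP Y
      refine ⟨X', ?_⟩
      rw [hX', hF, fderiv_fderiv_partialTube hg' hξ' (hJ.mono fun t ht => h.contDiffAt_α ht) X]
      exact Prod.ext hY.symm rfl)
  refine ⟨T, ?_, hT0, fun ζ hζ => ?_⟩
  · rw [IsVerticalTangent, normalProduct, hdF]
    exact ⟨hT1, hT2⟩
  · rw [normalProduct, hdF] at hζ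
    obtain ⟨A, hAs, hAc⟩ := hA ζ hζ.1 hζ.2
    refine ⟨A, fun X Y => ?_, hAc⟩
    rw [hdF, secondDerivative, hFc, hcxs]
    exact hAs X Y

end IsPartialTubeData

end Direct

end ClassA

theorem theorem2 (ε : SignType) (n : ℕ) :
    (∀ (p k : ℕ) (N : Type*) [TopologicalSpace N] [ChartedSpace (EuclideanSpace ℝ (Fin p)) N]
        [IsManifold (𝓡 p) ∞ N] (g : N → ClassA.Flat n) (ξ : Fin k → N → ClassA.Flat n)
        (J : Set ℝ) (α : ℝ → ClassA.Flat k × ℝ),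
        ClassA.IsPartialTubeData (𝓡 p) ε g ξ J α →
        (∀ (x : N), ∀ s ∈ J, ClassA.partialTube g ξ α (x, s) ∈ ClassA.productSpace ε n) ∧
        ∀ (x : N), ∀ s ∈ J,
          Function.Injective (ClassA.differential ((𝓡 p).prod 𝓘(ℝ, ℝ))
            (ClassA.partialTube g ξ α) (x, s)) →
          ClassA.InClassAAt ((𝓡 p).prod 𝓘(ℝ, ℝ)) ε (ClassA.partialTube g ξ α) (x, s)) ∧
    (∀ (m : ℕ), 2 ≤ m → ∀ (M : Type*) [TopologicalSpace M]
        [ChartedSpace (EuclideanSpace ℝ (Fin m)) M] [IsManifold (𝓡 m) ∞ M]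
        (f : M → ClassA.Flat n × ℝ), ClassA.InClassA (𝓡 m) ε f →
        ∀ x₀ : M, ∃ (k : ℕ) (N : TopologicalSpace.Opens (EuclideanSpace ℝ (Fin (m - 1))))
          (g : N → ClassA.Flat n) (ξ : Fin k → N → ClassA.Flat n)
          (J : Set ℝ) (α : ℝ → ClassA.Flat k × ℝ) (ψ : OpenPartialHomeomorph (N × ℝ) M),
          ClassA.IsPartialTubeData (𝓡 (m - 1)) ε g ξ J α ∧
          ψ.source = Set.univ ×ˢ J ∧
          x₀ ∈ ψ.target ∧
          ContMDiffOn ((𝓡 (m - 1)).prod 𝓘(ℝ, ℝ)) (𝓡 m) ∞ ψ ψ.source ∧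
          ContMDiffOn (𝓡 m) ((𝓡 (m - 1)).prod 𝓘(ℝ, ℝ)) ∞ ψ.symm ψ.target ∧
          ∀ q ∈ ψ.source, f (ψ q) = ClassA.partialTube g ξ α q) := by
  refine ⟨fun p k N _ _ _ g ξ J α h => ⟨fun x s hs => h.partialTube_mem x hs,
    fun x s hs himm => h.inClassAAt_partialTube x hs himm⟩, fun m hm M _ _ _ f hf x₀ => ?_⟩
  exact ClassA.exists_partialTube_parametrization (by omega) hf x₀
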